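/- Let $V$ be a finite set of points, each coloured with one colour of a finite set $\chi=\{c_1,\dots,c_k\}$; for $S\subseteq V$ let $c_j(S)$ be the set of points of $S$ of colour $c_j$. A clustering of $V$ is a partition of $V$ into nonempty clusters. A clustering $\mathcal F$ is \emph{fair} if every cluster $F\in\mathcal F$ satisfies $|c_1(F)|:\cdots:|c_k(F)|=|c_1(V)|:\cdots:|c_k(V)|$. The distance $\mathrm{dist}(\mathcal C,\mathcal C')$ of two clusterings of $V$ is the number of unordered pairs $\{u,v\}\subseteq V$ that lie in a common cluster in exactly one of $\mathcal C,\mathcal C'$. A fair clustering $\mathcal F$ is $\gamma$-close to a clustering $\mathcal D$ if $\mathrm{dist}(\mathcal D,\mathcal F)\le\gamma\cdot\mathrm{dist}(\mathcal D,\mathcal F^*)$, where $\mathcal F^*$ is a fair clustering of $V$ that minimizes the distance to $\mathcal D$. \textbf{Theorem.} There is a (deterministic) algorithm that, given any such coloured set $V$, with arbitrary colour proportions $|c_1(V)|:\cdots:|c_k(V)|$, and any clustering $\mathcal D$ of $V$, finds an $O(|\chi|^{3.81})$-close fair clustering $\mathcal F$ to $\mathcal D$ in time $O(|V|\log|V|)$.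 Both implied constants are absolute. Time is the number of elementary steps of a word RAM with word length at least a constant times $\log(|V|+|\chi|)$; the colours and cluster labels of the points are given in arrays, and the algorithm outputs an array of cluster labels. -/

import Mathlib

/-! ## Clusterings, distance, fairness -/

/-- A clustering of a finite point set `V`: a partition of `V` into nonempty clusters. -/
abbrev Clustering (V : Type*) [Fintype V] [DecidableEq V] : Type _ :=
  Finpartition (Finset.univ : Finset V)

namespace Clustering

variable {V : Type*} [Fintype V] [DecidableEq V]

/-- `u ∼ v` in the clustering `C`: both points lie in one common cluster of `C`. -/
def Together (C : Clustering V) (u v : V) : Prop :=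
  ∃ S ∈ C.parts, u ∈ S ∧ v ∈ S

/-- The number of unordered pairs `{u, v}` that are together in exactly one of the two clusterings
(a pair with `u = v` is together in both, hence never counted). -/
noncomputable def pairDist (C C' : Clustering V) : ℕ :=
  Set.ncard {e : Sym2 V | ∃ u v : V, e = s(u, v) ∧
    ((C.Together u v ∧ ¬ C'.Together u v) ∨ (¬ C.Together u v ∧ C'.Together u v))}

/-- The number of points of color `j` in the set `S`. -/
def colorCount {χ : Type*} [DecidableEq χ] (color : V → χ) (S : Finset V) (j : χ) : ℕ :=
  (S.filter fun v => color v = j).card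

/-- Equality `a₁ : a₂ : ⋯ = b₁ : b₂ : ⋯` of ratios, for families that are not identically zero. -/
def SameRatio {ι : Type*} (a b : ι → ℕ) : Prop :=
  ∀ i j, a i * b j = a j * b i

/-- Every cluster has the same color proportions as the whole point set. -/
def IsFair {χ : Type*} [DecidableEq χ] (color : V → χ) (F : Clustering V) : Prop :=
  ∀ S ∈ F.parts, SameRatio (colorCount color S) (colorCount color Finset.univ)

/-- `F` is a closest fair clustering to `D`. -/
def IsClosestFair {χ : Type*} [DecidableEq χ] (color : V → χ) (D F : Clustering V) : Prop :=
  F.IsFair color ∧ ∀ F' : Clustering V, F'.IsFair color → D.pairDist F ≤ D.pairDist F'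

/-- `F` is a `γ`-close fair clustering to `D`. -/
def IsCloseFair {χ : Type*} [DecidableEq χ] (γ : ℝ) (color : V → χ) (D F : Clustering V) : Prop :=
  F.IsFair color ∧ ∀ Fopt : Clustering V, IsClosestFair color D Fopt →
    (D.pairDist F : ℝ) ≤ γ * (D.pairDist Fopt : ℝ)

/-- A closest fair clustering always exists. -/
theorem exists_isClosestFair {χ : Type*} [DecidableEq χ] (color : V → χ) (D : Clustering V) :
    ∃ F : Clustering V, IsClosestFair color D F := by
  have hne : {F : Clustering V | F.IsFair color}.Nonempty := by
    refine ⟨⊤, fun S hS => ?_⟩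
    have : S = Finset.univ := by
      simpa using Finpartition.parts_top_subset (Finset.univ : Finset V) hS
    subst this
    intro i j
    exact mul_comm _ _
  refine ⟨Function.argminOn (fun F => D.pairDist F) _ hne,
    Function.argminOn_mem (fun F => D.pairDist F) _ hne, fun F' hF' => ?_⟩
  exact Function.argminOn_le (fun F => D.pairDist F) _ hF'

/-- The labelling `lab` represents the clustering `C`:
two points have the same label exactly if they are in the same cluster. -/
def Represents (C : Clustering V) (lab : V → ℕ) : Prop :=
  ∀ u v, C.Together u v ↔ lab u = lab v

end Clustering

/-! ## The word RAM

Programs are built from assignments, array stores, sequencing, conditionals and loops.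
A program mentions finitely many registers and arrays.  With word length `w`, arithmetic is
modulo `2 ^ w`, and every elementary operation (arithmetic operation, comparison, constant,
register access, indirect memory access, store, branch) costs one step. -/

namespace WordRAM

inductive BinOp : Type
  | add | sub | mul | div | mod | lt | eq

/-- Results are words; subtraction is truncated at `0`, comparisons return `1` or `0`. -/
def BinOp.eval (w : ℕ) : BinOp → ℕ → ℕ → ℕ
  | .add, x, y => (x + y) % 2 ^ w
  | .sub, x, y => x - y
  | .mul, x, y => (x * y) % 2 ^ w
  | .div, x, y => x / y
  | .mod, x, y => x % y
  | .lt, x, y => if x < y then 1 else 0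
  | .eq, x, y => if x = y then 1 else 0

/-- Memory: registers, and arrays (array number, then address). -/
structure State : Type where
  reg : ℕ → ℕ
  arr : ℕ → ℕ → ℕ

inductive Expr : Type
  | lit (m : ℕ)
  | reg (r : ℕ)
  | load (a : ℕ) (i : Expr)
  | bin (op : BinOp) (e₁ e₂ : Expr)

def Expr.eval (w : ℕ) (s : State) : Expr → ℕ
  | .lit m => m % 2 ^ w
  | .reg r => s.reg r
  | .load a i => s.arr a (i.eval w s)
  | .bin op e₁ e₂ => op.eval w (e₁.eval w s) (e₂.eval w s)

/-- The number of elementary operations needed to evaluate an expression. -/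
def Expr.cost : Expr → ℕ
  | .lit _ => 1
  | .reg _ => 1
  | .load _ i => i.cost + 1
  | .bin _ e₁ e₂ => e₁.cost + e₂.cost + 1

inductive Program : Type
  | skip
  | assign (r : ℕ) (e : Expr)
  | store (a : ℕ) (i e : Expr)
  | seq (p q : Program)
  | ite (b : Expr) (p q : Program)
  | while (b : Expr) (p : Program)

def State.setReg (s : State) (r x : ℕ) : State :=
  { s with reg := Function.update s.reg r x }

def State.setArr (s : State) (a i x : ℕ) : State :=
  { s with arr := Function.update s.arr a (Function.update (s.arr a) i x) }

/-- `Runs w p s t s'`: with word length `w`, the program `p` started in `s` halts in state `s'`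
after exactly `t` steps.  A test succeeds if its value is not `0`. -/
inductive Runs (w : ℕ) : Program → State → ℕ → State → Prop
  | skip (s : State) : Runs w .skip s 1 s
  | assign (r : ℕ) (e : Expr) (s : State) :
      Runs w (.assign r e) s (e.cost + 1) (s.setReg r (e.eval w s))
  | store (a : ℕ) (i e : Expr) (s : State) :
      Runs w (.store a i e) s (i.cost + e.cost + 1) (s.setArr a (i.eval w s) (e.eval w s))
  | seq {p q : Program} {s s' s'' : State} {t t' : ℕ} :
      Runs w p s t s' → Runs w q s' t' s'' → Runs w (.seq p q) s (t + t') s''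
  | ite_true {b : Expr} {p q : Program} {s s' : State} {t : ℕ} :
      b.eval w s ≠ 0 → Runs w p s t s' → Runs w (.ite b p q) s (b.cost + 1 + t) s'
  | ite_false {b : Expr} {p q : Program} {s s' : State} {t : ℕ} :
      b.eval w s = 0 → Runs w q s t s' → Runs w (.ite b p q) s (b.cost + 1 + t) s'
  | while_true {b : Expr} {p : Program} {s s' s'' : State} {t t' : ℕ} :
      b.eval w s ≠ 0 → Runs w p s t s' → Runs w (.while b p) s' t' s'' →
      Runs w (.while b p) s (b.cost + 1 + t + t') s''
  | while_false {b : Expr} {p : Program} {s : State} :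
      b.eval w s = 0 → Runs w (.while b p) s (b.cost + 1) s

/-- The initial memory for a colored point set `{0, …, n - 1}` with colors in `{0, …, k - 1}` and a
clustering given by cluster labels: register `0` holds `n`, register `1` holds `k`,
array `0` holds the colors, array `1` holds the labels, and all other memory is `0`. -/
def inputState {n k : ℕ} (color : Fin n → Fin k) (lab : Fin n → Fin n) : State where
  reg r := if r = 0 then n else if r = 1 then k else 0
  arr a i :=
    if h : i < n then
      if a = 0 then (color ⟨i, h⟩ : ℕ) else if a = 1 then (lab ⟨i, h⟩ : ℕ) else 0
    else 0

/-- The output labelling is read from array `2`. -/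
def outputLabels (n : ℕ) (s : State) : Fin n → ℕ := fun v => s.arr 2 v

end WordRAM

/-! Let `g` be the gcd of the colour frequencies and `p` the primitive vector with frequencies `g *
p j`; write k for the number of colours and P for the sum of `p`. A cluster is fair exactly when its
colour vector is a positive multiple of `p` (`sameRatio_iff_exists_mul`), so a fair clustering
distributes `g` units, each a copy of `p`. The algorithm rounds, in each cluster, the count of a
most frequent colour `m` to the nearest multiple of `p m`, and grants that many units. If this
exceeds `g` in total, the surplus is withdrawn from smaller clusters first; if it falls short, every
missing unit becomes a new cluster. Each cluster keeps as many of its own points as its units allow,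
and the remaining points fill the gaps of their colour in any order.

Lower bound for the optimum: twice the distance is the sum over points `u` of the symmetric
difference of the two clusters of `u` (`two_mul_pairDist`). For a fair clustering this difference is
at least the ℓ¹-distance of the colour vector of the old cluster from some positive multiple of `p`.
As `p m` is the largest entry, rounding in colour `m` is within a factor 2k + 1 of the best multiple
(`sum_abs_sub_round_le`). Hence the rounding errors, weighted by cluster sizes, cost at most 2(2k +
1) times the optimum. If units are withdrawn, their total mass is at most the total deficit created
by rounding, and an exchange argument shows that taking them from small clusters costs at most twice
the weighted deficits (`sum_mul_withdrawn_le`). The factor 2 is the price of comparing sizes only by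
binary length.

Upper bound for the output: only pairs containing a moved point change (`sum_card_disagree_le`), so
each moved point is charged its old and its new cluster. An old cluster grows at most to 2k times
its size, and a new cluster has size P, which is at most the old cluster of `u` plus the optimal
disagreement at `u`. Altogether this gives the factor 38k² of `pairDist_le`.

Running time: one run of Euclid's algorithm per point, and one linear pass per binary length to list
the units in sorted order, take O(n log n); everything else is linear. Tables indexed by pairs of a
label and a colour start blank and are touched only at entries named by points, so k does not enter
the time. -/

namespace Clustering

/-! ### Distance as a sum of local disagreements. -/

section Distance

variable {V : Type*} [Fintype V] [DecidableEq V]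

open Classical in
/-- The points on which `C` and `C'` disagree about being together with `u`. -/
noncomputable def disagree (C C' : Clustering V) (u : V) : Finset V :=
  {v | (C.Together u v ∧ ¬ C'.Together u v) ∨ (¬ C.Together u v ∧ C'.Together u v)}

theorem mem_disagree {C C' : Clustering V} {u v : V} : v ∈ C.disagree C' u ↔
    (C.Together u v ∧ ¬ C'.Together u v) ∨ (¬ C.Together u v ∧ C'.Together u v) := by
  simp [disagree]

theorem together_comm {C : Clustering V} {u v : V} : C.Together u v ↔ C.Together v u := by
  simp only [Together]
  constructor <;> rintro ⟨S, hS, h1, h2⟩ <;> exact ⟨S, hS, h2, h1⟩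

theorem together_refl (C : Clustering V) (u : V) : C.Together u u :=
  ⟨C.part u, C.part_mem.2 (Finset.mem_univ u), C.mem_part (Finset.mem_univ u),
    C.mem_part (Finset.mem_univ u)⟩

theorem together_iff_mem_part {C : Clustering V} {u v : V} : C.Together u v ↔ v ∈ C.part u := by
  rw [C.mem_part_iff_exists]
  simp only [Together]
  constructor <;> rintro ⟨S, hS, h1, h2⟩ <;> exact ⟨S, hS, h2, h1⟩

theorem mem_disagree_comm {C C' : Clustering V} {u v : V} :
    v ∈ C.disagree C' u ↔ u ∈ C.disagree C' v := by
  rw [mem_disagree, mem_disagree, together_comm (C := C), together_comm (C := C')]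

/-- This is the handshake lemma for the graph whose edges are the pairs on which the clusterings
differ. It turns a global count of pairs into a charge at each point. -/
theorem two_mul_pairDist (C C' : Clustering V) :
    2 * C.pairDist C' = ∑ u, (C.disagree C' u).card := by
  classical
  let G : SimpleGraph V :=
    { Adj := fun u v => v ∈ C.disagree C' u
      symm := ⟨fun u v h => mem_disagree_comm.1 h⟩
      loopless := ⟨fun u h => by
        have h1 := C.together_refl u
        have h2 := C'.together_refl u
        have := mem_disagree.1 h
        tauto⟩ }
  have hE : {e : Sym2 V | ∃ u v : V, e = s(u, v) ∧
      ((C.Together u v ∧ ¬ C'.Together u v) ∨ (¬ C.Together u v ∧ C'.Together u v))}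
      = (G.edgeFinset : Set (Sym2 V)) := by
    ext e
    induction e with | _ a b => ?_
    simp only [Set.mem_ofPred_eq, SimpleGraph.coe_edgeFinset, SimpleGraph.mem_edgeSet]
    constructor
    · rintro ⟨u, v, huv, h⟩
      have h' : v ∈ C.disagree C' u := mem_disagree.2 h
      rcases Sym2.eq_iff.1 huv with ⟨rfl, rfl⟩ | ⟨rfl, rfl⟩
      · exact h'
      · exact mem_disagree_comm.1 h'
    · intro h
      exact ⟨a, b, rfl, mem_disagree.1 h⟩
  rw [pairDist, hE, Set.ncard_coe_finset, ← G.sum_degrees_eq_twice_card_edges]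
  refine Finset.sum_congr rfl fun u _ => ?_
  rw [← G.card_neighborFinset_eq_degree]
  congr 1
  ext v
  simp [G]

end Distance

/-! ### Fair clusters and the primitive colour vector. -/

section Fair

variable {V : Type*} [Fintype V] [DecidableEq V] {χ : Type*} [Fintype χ] [DecidableEq χ]

omit [Fintype V] [DecidableEq V] in
theorem sum_colorCount (color : V → χ) (S : Finset V) : ∑ j, colorCount color S j = S.card :=
  (Finset.card_eq_sum_card_fiberwise (fun v _ => Finset.mem_univ (color v))).symm

-- Proportionality gives |S| · `p i` = P · (number of points of colour `i` in `S`) with P = ∑ `p j`.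
-- So P divides the gcd of all |S| · `p i`, which is |S| because `p` is primitive; the quotient is
-- the multiplier.
omit [DecidableEq V] in
theorem sameRatio_iff_exists_mul {color : V → χ} {g : ℕ} {p : χ → ℕ} (hg : 0 < g)
    (hp : ∀ j, colorCount color Finset.univ j = g * p j)
    (hprim : ∀ m, (∀ j, m ∣ p j) → m = 1) {S : Finset V} (hS : S.Nonempty) :
    SameRatio (colorCount color S) (colorCount color Finset.univ) ↔
      ∃ T, 1 ≤ T ∧ ∀ j, colorCount color S j = T * p j := by
  constructor
  · intro h
    have h1 : ∀ i, S.card * p i = colorCount color S i * ∑ j, p j := by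
      intro i
      have : g * (S.card * p i) = g * (colorCount color S i * ∑ j, p j) := by
        rw [← sum_colorCount color S, Finset.sum_mul, Finset.mul_sum, Finset.mul_sum,
          Finset.mul_sum]
        refine Finset.sum_congr rfl fun j _ => ?_
        have := h j i
        rw [hp, hp] at this
        linarith
      exact Nat.eq_of_mul_eq_mul_left hg this
    have h2 : (∑ j, p j) ∣ S.card := by
      have hgcd : Finset.univ.gcd p = 1 :=
        hprim _ fun j => Finset.gcd_dvd (Finset.mem_univ j)
      have : (∑ j, p j) ∣ Finset.univ.gcd fun i => S.card * p i :=
        Finset.dvd_gcd fun i _ => ⟨colorCount color S i, by rw [h1 i, mul_comm]⟩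
      rwa [Finset.gcd_mul_left, hgcd, mul_one, normalize_eq] at this
    obtain ⟨T, hT⟩ := h2
    have hpos := hS.card_pos
    have hP : 0 < ∑ j, p j := by
      rcases Nat.eq_zero_or_pos (∑ j, p j) with h0 | h0
      · rw [h0, zero_mul] at hT; omega
      · exact h0
    refine ⟨T, ?_, fun j => ?_⟩
    · rcases Nat.eq_zero_or_pos T with h0 | h0
      · rw [h0, mul_zero] at hT; omega
      · exact h0
    · have := h1 j
      rw [hT] at this
      exact Nat.eq_of_mul_eq_mul_right hP (by linarith)
  · rintro ⟨T, -, h⟩ i j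
    rw [h, h, hp, hp]
    ring

/-- In each colour the counts differ by at most the number of points of that colour in the symmetric
difference. This converts colour imbalance into a lower bound for disagreement. -/
theorem abs_colorCount_sub_le (color : V → χ) (A B : Finset V) :
    ∑ j, |(colorCount color A j : ℤ) - colorCount color B j| ≤ (symmDiff A B).card := by
  rw [← sum_colorCount color (symmDiff A B)]
  push_cast
  refine Finset.sum_le_sum fun j _ => ?_
  have h1 : ∀ A B : Finset V, colorCount color A j ≤
      colorCount color B j + colorCount color (symmDiff A B) j := by
    intro A B
    unfold colorCount
    refine (Finset.card_le_card ?_).trans (Finset.card_union_le _ _)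
    intro v
    simp only [Finset.mem_filter, Finset.mem_union, Finset.mem_symmDiff]
    tauto
  have h2 := h1 A B
  have h3 := h1 B A
  rw [symmDiff_comm] at h3
  rw [abs_le]
  constructor <;> omega

end Fair

/-! ### Rounding and the exchange inequality. -/

section Arithmetic

theorem abs_sub_round_le (d p : ℕ) (hp : 0 < p) :
    2 * |(d : ℤ) - ((d + p / 2) / p : ℕ) * p| ≤ p := by
  have h1 := Nat.div_add_mod (d + p / 2) p
  have h2 := Nat.mod_lt (d + p / 2) hp
  have h3 : (((d + p / 2) / p : ℕ) : ℤ) * p + ((d + p / 2) % p : ℕ) = d + (p / 2 : ℕ) := by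
    have : ((p * ((d + p / 2) / p) + (d + p / 2) % p : ℕ) : ℤ) = ((d + p / 2 : ℕ) : ℤ) := by
      rw [h1]
    push_cast at this ⊢
    linarith
  have : |(d : ℤ) - ((d + p / 2) / p : ℕ) * p| = |((d + p / 2) % p : ℕ) - ((p / 2 : ℕ) : ℤ)| := by
    congr 1; linarith
  rw [this]
  have : |((d + p / 2) % p : ℕ) - ((p / 2 : ℕ) : ℤ)| ≤ (p / 2 : ℕ) := by
    rw [abs_le]; omega
  omega

/-- Distinct multiples of `p` are at least `p` apart, and the chosen one lies within p/2 of `d`. -/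
theorem abs_sub_round_le_abs_sub (d p : ℕ) (hp : 0 < p) (T : ℤ) :
    |(d : ℤ) - ((d + p / 2) / p : ℕ) * p| ≤ |(d : ℤ) - T * p| := by
  have h := abs_sub_round_le d p hp
  set t : ℤ := (((d + p / 2) / p : ℕ) : ℤ) with ht
  by_cases hT : T = t
  · rw [hT]
  have h1 : (p : ℤ) ≤ |(T - t) * p| := by
    rw [abs_mul, abs_of_nonneg (by positivity : (0 : ℤ) ≤ p)]
    have : 1 ≤ |T - t| := Int.one_le_abs (sub_ne_zero.2 hT)
    nlinarith [(by positivity : (0 : ℤ) ≤ p)]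
  have h2 : |(T - t) * p| ≤ |(d : ℤ) - t * p| + |(d : ℤ) - T * p| := by
    have : (T - t) * p = ((d : ℤ) - t * p) - ((d : ℤ) - T * p) := by ring
    rw [this]
    exact abs_sub _ _
  linarith

/-- If the quotient is positive, then `p` is at most d + p/2, so the p/2 added for rounding is at
most `d`. -/
theorem round_mul_le (d p : ℕ) : (d + p / 2) / p * p ≤ 2 * d := by
  have h1 := Nat.div_mul_le_self (d + p / 2) p
  rcases Nat.eq_zero_or_pos ((d + p / 2) / p) with h | h
  · rw [h]; omega
  · have : p ≤ (d + p / 2) / p * p := Nat.le_mul_of_pos_left p h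
    omega

variable {χ : Type*} [Fintype χ]

/-- Rounding with respect to a heaviest color is good for all colors simultaneously. -/
theorem sum_abs_sub_round_le (d p : χ → ℕ) (m : χ) (hm : ∀ j, p j ≤ p m) (hpos : 0 < p m)
    (T : ℤ) :
    ∑ j, |(d j : ℤ) - ((d m + p m / 2) / p m : ℕ) * p j| ≤
      (2 * Fintype.card χ + 1) * ∑ j, |(d j : ℤ) - T * p j| := by
  set t : ℤ := (((d m + p m / 2) / p m : ℕ) : ℤ) with ht
  set δ := ∑ j, |(d j : ℤ) - T * p j| with hδ
  have h0 : |(d m : ℤ) - T * p m| ≤ δ :=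
    Finset.single_le_sum (f := fun j => |(d j : ℤ) - T * p j|) (fun _ _ => abs_nonneg _)
      (Finset.mem_univ m)
  -- In colour `m` both multiples lie within `δ` of `d m`, since `t` is the nearest one there. As `p
  -- j ≤ p m`, replacing `T` by `t` costs at most 2`δ` in every other colour too.
  have h1 : |T - t| * p m ≤ 2 * δ := by
    have h2 : |T - t| * p m = |(T - t) * p m| := by
      rw [abs_mul, abs_of_nonneg (by positivity : (0 : ℤ) ≤ p m)]
    have h3 : (T - t) * p m = ((d m : ℤ) - t * p m) - ((d m : ℤ) - T * p m) := by ring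
    have h4 := abs_sub ((d m : ℤ) - t * p m) ((d m : ℤ) - T * p m)
    have h5 := abs_sub_round_le_abs_sub (d m) (p m) hpos T
    rw [h2, h3]
    linarith
  have h6 : ∀ j, |(d j : ℤ) - t * p j| ≤ |(d j : ℤ) - T * p j| + 2 * δ := by
    intro j
    have h7 : (d j : ℤ) - t * p j = ((d j : ℤ) - T * p j) + (T - t) * p j := by ring
    have h8 : |(T - t) * p j| ≤ 2 * δ := by
      rw [abs_mul, abs_of_nonneg (by positivity : (0 : ℤ) ≤ p j)]
      refine le_trans ?_ h1
      exact mul_le_mul_of_nonneg_left (by exact_mod_cast hm j) (abs_nonneg _)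
    rw [h7]
    exact (abs_add_le _ _).trans (by linarith)
  calc ∑ j, |(d j : ℤ) - t * p j| ≤ ∑ j, (|(d j : ℤ) - T * p j| + 2 * δ) :=
        Finset.sum_le_sum fun j _ => h6 j
    _ = (2 * Fintype.card χ + 1) * δ := by
        rw [Finset.sum_add_distrib, Finset.sum_const, Finset.card_univ, nsmul_eq_mul, ← hδ]
        ring

/-- Subtracting a nonnegative price `σ` from all costs changes the comparison in a known direction,
because `z` has the smaller total. It remains to compare term by term: `z` exceeds `y` only below
the price and falls short only above it. -/
theorem sum_mul_le_of_threshold {ι : Type*} (I : Finset ι) (c z y : ι → ℤ) (σ : ℤ) (hσ : 0 ≤ σ)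
    (hsum : ∑ i ∈ I, z i ≤ ∑ i ∈ I, y i) (h : ∀ i ∈ I, (c i - σ) * (z i - y i) ≤ 0) :
    ∑ i ∈ I, c i * z i ≤ ∑ i ∈ I, c i * y i := by
  have h1 := Finset.sum_nonpos h
  have h2 : ∑ i ∈ I, (c i - σ) * (z i - y i) =
      ∑ i ∈ I, c i * z i - ∑ i ∈ I, c i * y i - σ * (∑ i ∈ I, z i - ∑ i ∈ I, y i) := by
    rw [← Finset.sum_sub_distrib, ← Finset.sum_sub_distrib, Finset.mul_sum,
      ← Finset.sum_sub_distrib]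
    exact Finset.sum_congr rfl fun i _ => by ring
  nlinarith

theorem lt_two_pow_size_le (s : ℕ) : s ≤ 2 ^ s.size ∧ (0 < s → 2 ^ s.size ≤ 2 * s) := by
  refine ⟨(Nat.lt_size_self s).le, fun h => ?_⟩
  have h1 : 0 < s.size := Nat.size_pos.2 h
  have h2 : 2 ^ (s.size - 1) ≤ s := Nat.lt_size.1 (by omega)
  have h3 : 2 ^ s.size = 2 * 2 ^ (s.size - 1) := by
    rw [← pow_succ']; congr 1; omega
  omega

/-- Withdrawing units from the smallest clusters first, sizes being compared up to a factor `2`,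
costs at most twice the fractional optimum. -/
theorem sum_mul_withdrawn_le (N : ℕ) (s t t' : ℕ → ℕ) (P : ℕ) (y : ℕ → ℤ)
    (hy : ∀ i, 0 ≤ y i) (hyt : ∀ i, y i ≤ t i * P) (h0 : ∀ i, s i = 0 → t i = 0)
    (ht : ∀ i < N, t' i ≤ t i)
    (hord : ∀ i < N, ∀ i' < N, t' i < t i → t' i' ≠ 0 → (s i).size ≤ (s i').size)
    (hsum : ∑ i ∈ Finset.range N, (((t i : ℤ) - t' i) * P) ≤ ∑ i ∈ Finset.range N, y i) :
    ∑ i ∈ Finset.range N, (s i : ℤ) * (((t i : ℤ) - t' i) * P) ≤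
      2 * ∑ i ∈ Finset.range N, (s i : ℤ) * y i := by
  -- With sizes replaced by powers of two, the withdrawal is exactly greedy. The price is the weight
  -- of the highest level from which anything was withdrawn: lower levels are exhausted, higher ones
  -- untouched.
  have key : ∑ i ∈ Finset.range N, (2 ^ (s i).size : ℤ) * (((t i : ℤ) - t' i) * P) ≤
      ∑ i ∈ Finset.range N, (2 ^ (s i).size : ℤ) * y i := by
    by_cases hne : ((Finset.range N).filter fun i => t' i < t i).Nonempty
    · obtain ⟨i₀, hi₀, hmax⟩ := Finset.exists_max_image _ (fun i => (s i).size) hne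
      rw [Finset.mem_filter, Finset.mem_range] at hi₀
      refine sum_mul_le_of_threshold _ _ _ _ (2 ^ (s i₀).size) (by positivity) hsum ?_
      intro i hi
      rw [Finset.mem_range] at hi
      rcases lt_trichotomy (s i).size (s i₀).size with hlt | heq | hgt
      · have h1 : t' i = 0 := by
          by_contra h
          have := hord i₀ hi₀.1 i hi hi₀.2 h
          omega
        have h2 : (2 ^ (s i).size : ℤ) ≤ 2 ^ (s i₀).size :=
          pow_le_pow_right₀ (by norm_num) hlt.le
        refine mul_nonpos_of_nonpos_of_nonneg (by linarith) ?_
        have := hyt i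
        rw [h1]
        push_cast
        linarith
      · rw [heq]; simp
      · have h1 : t' i = t i := by
          by_contra h
          have h3 := ht i hi
          have := hmax i (by rw [Finset.mem_filter, Finset.mem_range]; exact ⟨hi, by omega⟩)
          omega
        have h2 : (2 ^ (s i₀).size : ℤ) ≤ 2 ^ (s i).size :=
          pow_le_pow_right₀ (by norm_num) hgt.le
        refine mul_nonpos_of_nonneg_of_nonpos (by linarith) ?_
        have := hy i
        rw [h1]
        linarith
    · refine Finset.sum_le_sum fun i hi => ?_
      have h1 : t' i = t i := by
        by_contra h
        have h3 := ht i (Finset.mem_range.1 hi)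
        exact hne ⟨i, by rw [Finset.mem_filter]; exact ⟨hi, by omega⟩⟩
      rw [h1, sub_self, zero_mul, mul_zero]
      exact mul_nonneg (by positivity) (hy i)
  calc _ ≤ ∑ i ∈ Finset.range N, (2 ^ (s i).size : ℤ) * (((t i : ℤ) - t' i) * P) := by
        refine Finset.sum_le_sum fun i hi => ?_
        have h1 : (s i : ℤ) ≤ 2 ^ (s i).size := by exact_mod_cast (lt_two_pow_size_le (s i)).1
        refine mul_le_mul_of_nonneg_right h1 (mul_nonneg ?_ (by positivity))
        have := ht i (Finset.mem_range.1 hi)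
        omega
    _ ≤ _ := key
    _ ≤ _ := by
        rw [Finset.mul_sum]
        refine Finset.sum_le_sum fun i _ => ?_
        rcases Nat.eq_zero_or_pos (s i) with h | h
        · have h1 := hyt i
          have h2 := hy i
          rw [h0 i h] at h1
          have : y i = 0 := by push_cast at h1; linarith
          rw [this]; simp
        · have h1 : (2 ^ (s i).size : ℤ) ≤ 2 * s i := by
            exact_mod_cast (lt_two_pow_size_le (s i)).2 h
          rw [← mul_assoc]
          exact mul_le_mul_of_nonneg_right h1 (hy i)

end Arithmetic

end Clustering

namespace Clustering

/-! ### The approximation guarantee of the rounding. -/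

section Approximation

variable {V : Type*} [Fintype V] [DecidableEq V] {χ : Type*} [Fintype χ] [DecidableEq χ]

/-- The points with label `i`. -/
def fiber (lab : V → ℕ) (i : ℕ) : Finset V := {v | lab v = i}

omit [DecidableEq V] in
theorem mem_fiber {lab : V → ℕ} {i : ℕ} {v : V} : v ∈ fiber lab i ↔ lab v = i := by
  simp [fiber]

/-- The outcome of rounding the clustering given by `lab`: in the clustering given by `out`, the
cluster `i < N` keeps as many of its points as possible subject to consisting of `t' i` copies of
the primitive color vector `p`. Here `t' i` is at most the rounding `t i` of the size of the
cluster measured in the most frequent color `m`, units are withdrawn from smaller clusters first,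
and labels from `N` on stand for new clusters, which are needed only if no unit is withdrawn. -/
structure IsRounding (color : V → χ) (lab out : V → ℕ) (N g : ℕ) (p : χ → ℕ) (m : χ)
    (t' : ℕ → ℕ) : Prop where
  lab_lt : ∀ v, lab v < N
  pos : 0 < g
  count_univ : ∀ j, colorCount color Finset.univ j = g * p j
  primitive : ∀ a, (∀ j, a ∣ p j) → a = 1
  le_max : ∀ j, p j ≤ p m
  max_pos : 0 < p m
  count_out : ∀ i j, colorCount color (fiber out i) j = t' i * p j
  count_keep : ∀ i < N, ∀ j, colorCount color (fiber lab i ∩ fiber out i) j =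
    min (colorCount color (fiber lab i) j) (t' i * p j)
  fresh_le : ∀ i, N ≤ i → t' i ≤ 1
  le_round : ∀ i < N, t' i ≤ (colorCount color (fiber lab i) m + p m / 2) / p m
  ordered : ∀ i < N, ∀ i' < N, t' i < (colorCount color (fiber lab i) m + p m / 2) / p m →
    t' i' ≠ 0 → (fiber lab i).card.size ≤ (fiber lab i').card.size
  fresh_or : (∀ i < N, t' i = (colorCount color (fiber lab i) m + p m / 2) / p m) ∨
    ∀ i, N ≤ i → t' i = 0

omit [Fintype V] [DecidableEq V] [Fintype χ] in
theorem colorCount_le (color : V → χ) (S : Finset V) (j : χ) : colorCount color S j ≤ S.card :=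
  Finset.card_filter_le _ _

theorem fiber_eq_part {C : Clustering V} {lab : V → ℕ} (h : C.Represents lab) (u : V) :
    fiber lab (lab u) = C.part u := by
  ext v
  rw [mem_fiber, ← together_iff_mem_part, h u v, eq_comm]

theorem disagree_eq_symmDiff (C C' : Clustering V) (u : V) :
    C.disagree C' u = symmDiff (C.part u) (C'.part u) := by
  ext v
  rw [mem_disagree, together_iff_mem_part, together_iff_mem_part, Finset.mem_symmDiff]
  tauto

/-- Two points that both keep their label cannot disagree. Every ordered disagreeing pair therefore
has a moved first or second entry, whence the factor 2; at a moved point the disagreement lies in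
the union of its two clusters. -/
theorem sum_card_disagree_le {C C' : Clustering V} {lab out : V → ℕ} (h : C.Represents lab)
    (h' : C'.Represents out) :
    ∑ u, (C.disagree C' u).card ≤ 2 * ∑ u with out u ≠ lab u,
      ((fiber lab (lab u)).card + (fiber out (out u)).card) := by
  set M : Finset V := {u | out u ≠ lab u} with hM
  have h1 : ∑ u, (C.disagree C' u).card ≤
      ∑ u ∈ M, (C.disagree C' u).card + ∑ u, ((C.disagree C' u).filter (· ∈ M)).card := by
    have hs : ∑ u ∈ M, (C.disagree C' u).card =
        ∑ u, if u ∈ M then (C.disagree C' u).card else 0 := by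
      rw [Finset.sum_ite_mem, Finset.univ_inter]
    rw [hs, ← Finset.sum_add_distrib]
    refine Finset.sum_le_sum fun u _ => ?_
    split_ifs with hu
    · omega
    · rw [zero_add]
      refine Finset.card_le_card fun v hv => Finset.mem_filter.2 ⟨hv, ?_⟩
      have h2 := mem_disagree.1 hv
      rw [h u v, h' u v] at h2
      simp only [hM, Finset.mem_filter, Finset.mem_univ, true_and, not_not] at hu ⊢
      intro h3
      rw [hu, h3] at h2
      tauto
  have h2 : ∑ u, ((C.disagree C' u).filter (· ∈ M)).card = ∑ u ∈ M, (C.disagree C' u).card := by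
    have := Finset.sum_card_bipartiteAbove_eq_sum_card_bipartiteBelow (s := Finset.univ) (t := M)
      (fun u v => v ∈ C.disagree C' u)
    refine Eq.trans ?_ (this.trans ?_)
    · refine Finset.sum_congr rfl fun u _ => congrArg _ ?_
      ext v
      simp [Finset.bipartiteAbove, and_comm]
    · refine Finset.sum_congr rfl fun u _ => congrArg _ ?_
      ext v
      simp [Finset.bipartiteBelow, mem_disagree_comm (u := u)]
  have h3 : ∑ u ∈ M, (C.disagree C' u).card ≤
      ∑ u ∈ M, ((fiber lab (lab u)).card + (fiber out (out u)).card) := by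
    refine Finset.sum_le_sum fun u _ => ?_
    rw [disagree_eq_symmDiff, fiber_eq_part h, fiber_eq_part h']
    exact (Finset.card_le_card symmDiff_le_sup).trans (Finset.card_union_le _ _)
  omega

namespace IsRounding

variable {color : V → χ} {lab out : V → ℕ} {N g : ℕ} {p : χ → ℕ} {m : χ} {t' : ℕ → ℕ}

theorem isFair (h : IsRounding color lab out N g p m t') {F : Clustering V}
    (hF : F.Represents out) : F.IsFair color := by
  intro S hS
  obtain ⟨u, hu⟩ := F.nonempty_of_mem_parts hS
  have h1 : S = fiber out (out u) := by
    rw [fiber_eq_part hF, F.part_eq_of_mem hS hu]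
  refine (sameRatio_iff_exists_mul h.pos h.count_univ h.primitive ⟨u, hu⟩).2 ⟨t' (out u), ?_, ?_⟩
  · by_contra h0
    have h2 : (fiber out (out u)).card = 0 := by
      rw [← sum_colorCount color, Finset.sum_eq_zero]
      intro j _
      rw [h.count_out, show t' (out u) = 0 by omega, zero_mul]
    rw [← h1, Finset.card_eq_zero] at h2
    simp [h2] at hu
  · intro j
    rw [h1, h.count_out]

/-- Every fair clustering disagrees with `D` at `u` at least as much as the color vector of the
cluster of `u` differs from some positive multiple of the primitive color vector. -/
theorem exists_sum_abs_le (h : IsRounding color lab out N g p m t') {D Fo : Clustering V}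
    (hD : D.Represents lab) (hFo : Fo.IsFair color) (u : V) :
    ∃ T : ℕ, 1 ≤ T ∧ ∑ j, |(colorCount color (fiber lab (lab u)) j : ℤ) - (T : ℤ) * p j| ≤
      (D.disagree Fo u).card := by
  have hu : u ∈ Fo.part u := Fo.mem_part (Finset.mem_univ u)
  obtain ⟨T, hT, hT'⟩ := (sameRatio_iff_exists_mul h.pos h.count_univ h.primitive ⟨u, hu⟩).1
    (hFo _ (Fo.part_mem.2 (Finset.mem_univ u)))
  refine ⟨T, hT, ?_⟩
  rw [disagree_eq_symmDiff, fiber_eq_part hD]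
  refine le_trans (le_of_eq ?_) (abs_colorCount_sub_le color _ _)
  refine Finset.sum_congr rfl fun j _ => ?_
  rw [hT' j]
  push_cast
  rfl

theorem card_out (h : IsRounding color lab out N g p m t') (i : ℕ) :
    (fiber out i).card = t' i * ∑ j, p j := by
  rw [← sum_colorCount color, Finset.mul_sum]
  exact Finset.sum_congr rfl fun j _ => h.count_out i j

/-- The fair cluster of `u` contains at least one full unit (`1 ≤ T`), so whatever the old cluster
lacks of a unit shows up as disagreement. This pays for moves into new clusters. -/
theorem sum_le_card_add (h : IsRounding color lab out N g p m t') {D Fo : Clustering V}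
    (hD : D.Represents lab) (hFo : Fo.IsFair color) (u : V) :
    ∑ j, p j ≤ (fiber lab (lab u)).card + (D.disagree Fo u).card := by
  obtain ⟨T, hT, hT'⟩ := h.exists_sum_abs_le hD hFo u
  have h1 : ∑ j, ((p j : ℤ) - colorCount color (fiber lab (lab u)) j) ≤
      ∑ j, |(colorCount color (fiber lab (lab u)) j : ℤ) - (T : ℤ) * p j| := by
    refine Finset.sum_le_sum fun j _ => ?_
    refine le_trans ?_ (neg_le_abs _)
    have : (p j : ℤ) ≤ T * p j := by exact_mod_cast Nat.le_mul_of_pos_left _ hT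
    linarith
  rw [Finset.sum_sub_distrib] at h1
  have h2 := sum_colorCount color (fiber lab (lab u))
  zify at h2 ⊢
  linarith

/-- Weighting an error by the cluster size means charging it once to each point of the cluster.
There it is compared with the disagreement of the fair clustering, whose multiple `T` may vary from
point to point. -/
theorem sum_card_mul_le (h : IsRounding color lab out N g p m t') {D Fo : Clustering V}
    (hD : D.Represents lab) (hFo : Fo.IsFair color) :
    ∑ i ∈ Finset.range N, ((fiber lab i).card : ℤ) *
      ∑ j, |(colorCount color (fiber lab i) j : ℤ) -
        ((colorCount color (fiber lab i) m + p m / 2) / p m : ℕ) * p j| ≤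
      (2 * Fintype.card χ + 1) * (2 * D.pairDist Fo) := by
  set e : ℕ → ℤ := fun i => ∑ j, |(colorCount color (fiber lab i) j : ℤ) -
        ((colorCount color (fiber lab i) m + p m / 2) / p m : ℕ) * p j| with he
  have h1 : ∑ i ∈ Finset.range N, ((fiber lab i).card : ℤ) * e i = ∑ u, e (lab u) := by
    rw [← Finset.sum_fiberwise_of_maps_to (s := Finset.univ) (t := Finset.range N) (g := lab)
      (fun v _ => Finset.mem_range.2 (h.lab_lt v))]
    refine Finset.sum_congr rfl fun i _ => ?_
    rw [Finset.sum_congr rfl (g := fun _ => e i)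
      (fun u hu => by rw [(Finset.mem_filter.1 hu).2]), Finset.sum_const, nsmul_eq_mul]
    rfl
  have h2 : (2 * D.pairDist Fo : ℤ) = ∑ u, ((D.disagree Fo u).card : ℤ) := by
    exact_mod_cast two_mul_pairDist D Fo
  rw [h1, h2, Finset.mul_sum]
  refine Finset.sum_le_sum fun u _ => ?_
  obtain ⟨T, -, hT⟩ := h.exists_sum_abs_le hD hFo u
  refine (sum_abs_sub_round_le _ p m h.le_max h.max_pos T).trans ?_
  exact mul_le_mul_of_nonneg_left hT (by positivity)

/-- A unit has at most k · `p m` points since `m` is heaviest, and rounding at most doubles the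
count of colour `m`. -/
theorem le_two_mul_card (h : IsRounding color lab out N g p m t') {i : ℕ} (hi : i < N) :
    t' i * ∑ j, p j ≤ 2 * Fintype.card χ * (fiber lab i).card := by
  have h1 : ∑ j, p j ≤ Fintype.card χ * p m := by
    rw [← smul_eq_mul, ← Finset.card_univ, ← Finset.sum_const]
    exact Finset.sum_le_sum fun j _ => h.le_max j
  have h2 := round_mul_le (colorCount color (fiber lab i) m) (p m)
  have h3 := colorCount_le color (fiber lab i) m
  calc t' i * ∑ j, p j ≤ (colorCount color (fiber lab i) m + p m / 2) / p m *
        (Fintype.card χ * p m) := Nat.mul_le_mul (h.le_round i hi) h1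
    _ = Fintype.card χ * ((colorCount color (fiber lab i) m + p m / 2) / p m * p m) := by ring
    _ ≤ Fintype.card χ * (2 * (fiber lab i).card) := Nat.mul_le_mul_left _ (by omega)
    _ = _ := by ring

omit [Fintype χ] in
theorem sum_card_fiber_lab (h : IsRounding color lab out N g p m t') :
    ∑ i ∈ Finset.range N, (fiber lab i).card = Fintype.card V := by
  rw [← Finset.card_univ]
  exact (Finset.card_eq_sum_card_fiberwise (fun v _ => Finset.mem_coe.2
    (Finset.mem_range.2 (h.lab_lt v)))).symm

omit [Fintype χ] in
theorem eq_zero_of_card_eq_zero (h : IsRounding color lab out N g p m t') {i : ℕ}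
    (h0 : (fiber lab i).card = 0) :
    (colorCount color (fiber lab i) m + p m / 2) / p m = 0 := by
  have h1 := colorCount_le color (fiber lab i) m
  rw [show colorCount color (fiber lab i) m = 0 by omega, zero_add]
  exact Nat.div_eq_of_lt (Nat.div_lt_self h.max_pos (by norm_num))

/-- The withdrawn units cost no more than the rounding errors. -/
theorem sum_card_mul_withdrawn_le (h : IsRounding color lab out N g p m t') :
    ∑ i ∈ Finset.range N, ((fiber lab i).card : ℤ) *
      (((((colorCount color (fiber lab i) m + p m / 2) / p m : ℕ) : ℤ) - t' i) *
        (∑ j, p j : ℕ)) ≤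
    2 * ∑ i ∈ Finset.range N, ((fiber lab i).card : ℤ) *
      ∑ j, |(colorCount color (fiber lab i) j : ℤ) -
        ((colorCount color (fiber lab i) m + p m / 2) / p m : ℕ) * p j| := by
  set t : ℕ → ℕ := fun i => (colorCount color (fiber lab i) m + p m / 2) / p m with ht
  rcases h.fresh_or with h1 | h1
  · rw [Finset.sum_eq_zero]
    · exact mul_nonneg (by norm_num) (Finset.sum_nonneg fun i _ => mul_nonneg (by positivity)
        (Finset.sum_nonneg fun j _ => abs_nonneg _))
    · intro i hi
      rw [h1 i (Finset.mem_range.1 hi)]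
      simp
  -- `y i` is the deficit of cluster `i`, the part of the rounding error that asks for additional
  -- points. Without new clusters the remaining units cover all points exactly, so the withdrawn
  -- mass is the total excess of the rounded sizes, at most the sum of the deficits.
  · set y : ℕ → ℤ := fun i => ∑ j, max ((t i : ℤ) * p j - colorCount color (fiber lab i) j) 0
      with hy
    have h2 : ∑ i ∈ Finset.range N, (((t i : ℤ) - t' i) * (∑ j, p j : ℕ)) ≤
        ∑ i ∈ Finset.range N, y i := by
      have h3 : ∑ i ∈ Finset.range N, (t' i * ∑ j, p j) = Fintype.card V := by
        have h4 : ∀ v, out v < N := by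
          intro v
          by_contra hv
          have h5 := h.card_out (out v)
          rw [h1 _ (not_lt.1 hv), zero_mul, Finset.card_eq_zero] at h5
          have : v ∈ fiber out (out v) := mem_fiber.2 rfl
          simp [h5] at this
        rw [← Finset.card_univ, Finset.card_eq_sum_card_fiberwise (f := out)
          (t := Finset.range N) (fun v _ => Finset.mem_coe.2 (Finset.mem_range.2 (h4 v)))]
        exact Finset.sum_congr rfl fun i _ => (h.card_out i).symm
      have h4 := h.sum_card_fiber_lab
      rw [← h3] at h4
      zify at h4
      have h5 : ∑ i ∈ Finset.range N, (((t i : ℤ) - t' i) * (∑ j, p j : ℕ)) =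
          ∑ i ∈ Finset.range N, ((t i : ℤ) * (∑ j, p j : ℕ) - (fiber lab i).card) := by
        rw [Finset.sum_sub_distrib, h4, ← Finset.sum_sub_distrib]
        refine Finset.sum_congr rfl fun i _ => ?_
        push_cast
        ring
      rw [h5]
      refine Finset.sum_le_sum fun i _ => ?_
      rw [← sum_colorCount color (fiber lab i)]
      push_cast
      rw [Finset.mul_sum, ← Finset.sum_sub_distrib]
      exact Finset.sum_le_sum fun j _ => le_max_left _ _
    refine (sum_mul_withdrawn_le N (fun i => (fiber lab i).card) t t' (∑ j, p j) y
      (fun i => Finset.sum_nonneg fun j _ => le_max_right _ _) ?_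
      (fun i hi => h.eq_zero_of_card_eq_zero hi) h.le_round h.ordered h2).trans ?_
    · intro i
      push_cast
      rw [Finset.mul_sum]
      refine Finset.sum_le_sum fun j _ => max_le ?_ (by positivity)
      linarith [(by positivity : (0 : ℤ) ≤ colorCount color (fiber lab i) j)]
    · refine mul_le_mul_of_nonneg_left ?_ (by norm_num)
      refine Finset.sum_le_sum fun i _ => mul_le_mul_of_nonneg_left ?_ (by positivity)
      refine Finset.sum_le_sum fun j _ => max_le ?_ (abs_nonneg _)
      refine le_trans (le_of_eq ?_) (neg_le_abs _)
      ring

/-- In each colour a cluster keeps the minimum of what it has and what it needs, and |a - b| = a + b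
- 2 min(a, b). -/
theorem card_leaving_add_card_entering (h : IsRounding color lab out N g p m t') {i : ℕ}
    (hi : i < N) :
    (((fiber lab i \ fiber out i).card + (fiber out i \ fiber lab i).card : ℕ) : ℤ) =
      ∑ j, |(colorCount color (fiber lab i) j : ℤ) - t' i * p j| := by
  have h1 := Finset.card_sdiff_add_card_inter (fiber lab i) (fiber out i)
  have h2 := Finset.card_sdiff_add_card_inter (fiber out i) (fiber lab i)
  rw [Finset.inter_comm, ← sum_colorCount color (fiber lab i ∩ fiber out i),
    ← sum_colorCount color (fiber out i)] at h2
  rw [← sum_colorCount color (fiber lab i ∩ fiber out i),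
    ← sum_colorCount color (fiber lab i)] at h1
  have h3 : ∑ j, |(colorCount color (fiber lab i) j : ℤ) - t' i * p j| =
      ∑ j, (colorCount color (fiber lab i) j : ℤ) + ∑ j, (colorCount color (fiber out i) j : ℤ)
        - 2 * ∑ j, (colorCount color (fiber lab i ∩ fiber out i) j : ℤ) := by
    rw [Finset.mul_sum, ← Finset.sum_add_distrib, ← Finset.sum_sub_distrib]
    refine Finset.sum_congr rfl fun j _ => ?_
    rw [h.count_keep i hi j, h.count_out i j]
    push_cast
    generalize (colorCount color (fiber lab i) j : ℤ) = a
    generalize (t' i * p j : ℤ) = b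
    rcases le_total a b with hab | hab
    · rw [abs_of_nonpos (by linarith), min_eq_left hab]; ring
    · rw [abs_of_nonneg (by linarith), min_eq_right hab]; ring
  rw [h3]
  zify at h1 h2
  push_cast
  linarith

/-- Grouping moved points by old label accounts for the leaving terms. Grouping by new label, with
`le_two_mul_card`, accounts for entering old clusters. Points entering new clusters are paid by
`sum_le_card_add`, that is, by the leaving terms again and the disagreements with `Fo`. -/
theorem sum_moved_le (h : IsRounding color lab out N g p m t') {D Fo : Clustering V}
    (hD : D.Represents lab) (hFo : Fo.IsFair color) :
    ∑ u with out u ≠ lab u, ((fiber lab (lab u)).card + (fiber out (out u)).card) ≤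
      (2 * Fintype.card χ) * ∑ i ∈ Finset.range N, (fiber lab i).card *
        ((fiber lab i \ fiber out i).card + (fiber out i \ fiber lab i).card) +
      2 * D.pairDist Fo := by
  have hk : 1 ≤ Fintype.card χ := Fintype.card_pos_iff.2 ⟨m⟩
  set M : Finset V := {u | out u ≠ lab u} with hM
  have h1 : ∑ u ∈ M, (fiber lab (lab u)).card =
      ∑ i ∈ Finset.range N, (fiber lab i).card * (fiber lab i \ fiber out i).card := by
    rw [← Finset.sum_fiberwise_of_maps_to (s := M) (t := Finset.range N) (g := lab)
      (fun v _ => Finset.mem_range.2 (h.lab_lt v))]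
    refine Finset.sum_congr rfl fun i _ => ?_
    rw [Finset.sum_congr rfl (g := fun _ => (fiber lab i).card)
      (fun u hu => by rw [(Finset.mem_filter.1 hu).2]), Finset.sum_const, smul_eq_mul, mul_comm]
    congr 2
    ext v
    simp only [hM, Finset.mem_filter, Finset.mem_univ, true_and, Finset.mem_sdiff, mem_fiber]
    constructor
    · rintro ⟨h1, rfl⟩; exact ⟨rfl, h1⟩
    · rintro ⟨rfl, h1⟩; exact ⟨h1, rfl⟩
  have h2 : ∑ u ∈ M with out u < N, (fiber out (out u)).card ≤
      ∑ i ∈ Finset.range N, (2 * Fintype.card χ) *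
        ((fiber lab i).card * (fiber out i \ fiber lab i).card) := by
    rw [← Finset.sum_fiberwise_of_maps_to (s := M.filter (out · < N)) (t := Finset.range N)
      (g := out) (fun v hv => Finset.mem_range.2 (Finset.mem_filter.1 hv).2)]
    refine Finset.sum_le_sum fun i hi => ?_
    rw [Finset.mem_range] at hi
    rw [Finset.sum_congr rfl (g := fun _ => (fiber out i).card)
      (fun u hu => by rw [(Finset.mem_filter.1 hu).2]), Finset.sum_const, smul_eq_mul, ← mul_assoc,
      mul_comm]
    refine Nat.mul_le_mul ?_ (Finset.card_le_card ?_)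
    · rw [h.card_out]
      exact h.le_two_mul_card hi
    · intro v
      simp only [hM, Finset.mem_filter, Finset.mem_univ, true_and, Finset.mem_sdiff, mem_fiber]
      rintro ⟨⟨h1, -⟩, rfl⟩
      exact ⟨rfl, fun h => h1 h.symm⟩
  have h3 : ∑ u ∈ M with ¬ out u < N, (fiber out (out u)).card ≤
      ∑ u ∈ M, (fiber lab (lab u)).card + 2 * D.pairDist Fo := by
    calc _ ≤ ∑ u ∈ M with ¬ out u < N, ((fiber lab (lab u)).card + (D.disagree Fo u).card) := by
          refine Finset.sum_le_sum fun u hu => ?_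
          refine le_trans ?_ (h.sum_le_card_add hD hFo u)
          rw [h.card_out]
          calc _ ≤ 1 * ∑ j, p j :=
                Nat.mul_le_mul_right _ (h.fresh_le _ (not_lt.1 (Finset.mem_filter.1 hu).2))
            _ = _ := one_mul _
      _ ≤ ∑ u ∈ M, ((fiber lab (lab u)).card + (D.disagree Fo u).card) :=
          Finset.sum_le_sum_of_subset (Finset.filter_subset _ _)
      _ ≤ _ := by
          rw [Finset.sum_add_distrib, two_mul_pairDist]
          exact Nat.add_le_add_left (Finset.sum_le_sum_of_subset (Finset.subset_univ _)) _
  rw [Finset.sum_add_distrib, ← Finset.sum_filter_add_sum_filter_not M (out · < N)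
    (fun u => (fiber out (out u)).card)]
  rw [← Finset.mul_sum] at h2
  simp only [mul_add, Finset.sum_add_distrib]
  rw [h1] at h3 ⊢
  have h4 : 2 * ∑ i ∈ Finset.range N, (fiber lab i).card * (fiber lab i \ fiber out i).card ≤
    2 * Fintype.card χ *
      ∑ i ∈ Finset.range N, (fiber lab i).card * (fiber lab i \ fiber out i).card :=
    Nat.mul_le_mul_right _ (by omega)
  omega

/-- The change of a cluster is at most its rounding error plus its withdrawn units. The latter cost
in total at most twice the errors, so the bound 2(2k + 1) for the weighted errors is tripled. -/
theorem sum_card_mul_changed_le (h : IsRounding color lab out N g p m t') {D Fo : Clustering V}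
    (hD : D.Represents lab) (hFo : Fo.IsFair color) :
    ∑ i ∈ Finset.range N, (fiber lab i).card *
        ((fiber lab i \ fiber out i).card + (fiber out i \ fiber lab i).card) ≤
      6 * (2 * Fintype.card χ + 1) * D.pairDist Fo := by
  have h1 := h.sum_card_mul_le hD hFo
  have h2 := h.sum_card_mul_withdrawn_le
  zify
  calc ∑ i ∈ Finset.range N, ((fiber lab i).card : ℤ) *
        ((fiber lab i \ fiber out i).card + (fiber out i \ fiber lab i).card)
      ≤ ∑ i ∈ Finset.range N, (((fiber lab i).card : ℤ) *
          (((((colorCount color (fiber lab i) m + p m / 2) / p m : ℕ) : ℤ) - t' i) *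
            (∑ j, p j : ℕ)) + ((fiber lab i).card : ℤ) *
          ∑ j, |(colorCount color (fiber lab i) j : ℤ) -
            ((colorCount color (fiber lab i) m + p m / 2) / p m : ℕ) * p j|) := by
        refine Finset.sum_le_sum fun i hi => ?_
        rw [Finset.mem_range] at hi
        have h3 := h.card_leaving_add_card_entering hi
        push_cast at h3
        rw [h3, ← mul_add]
        refine mul_le_mul_of_nonneg_left ?_ (by positivity)
        rw [Nat.cast_sum, Finset.mul_sum, ← Finset.sum_add_distrib]
        refine Finset.sum_le_sum fun j _ => ?_
        have h4 := h.le_round i hi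
        generalize (colorCount color (fiber lab i) m + p m / 2) / p m = t at h4 ⊢
        have h5 : (t' i : ℤ) ≤ t := by exact_mod_cast h4
        have h6 : (colorCount color (fiber lab i) j : ℤ) - t' i * p j =
          (colorCount color (fiber lab i) j - t * p j) + (t - t' i) * p j := by ring
        rw [h6]
        refine (abs_add_le _ _).trans ?_
        rw [abs_of_nonneg (mul_nonneg (sub_nonneg.2 h5) (by positivity : (0 : ℤ) ≤ p j)),
          add_comm]
    _ ≤ _ := by
        rw [Finset.sum_add_distrib]
        linarith

theorem pairDist_le (h : IsRounding color lab out N g p m t') {D F Fo : Clustering V}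
    (hD : D.Represents lab) (hF : F.Represents out) (hFo : Fo.IsFair color) :
    D.pairDist F ≤ 38 * Fintype.card χ ^ 2 * D.pairDist Fo := by
  have hk : 1 ≤ Fintype.card χ := Fintype.card_pos_iff.2 ⟨m⟩
  have h1 := two_mul_pairDist D F
  have h2 := sum_card_disagree_le hD hF
  have h3 := h.sum_moved_le hD hFo
  have h4 := h.sum_card_mul_changed_le hD hFo
  generalize Fintype.card χ = k at *
  generalize D.pairDist Fo = o at *
  have h5 : D.pairDist F ≤ 2 * k * (6 * (2 * k + 1) * o) + 2 * o := by
    have := Nat.mul_le_mul_left (2 * k) h4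
    omega
  refine h5.trans ?_
  have h6 : 2 * k * (6 * (2 * k + 1) * o) + 2 * o = (24 * k ^ 2 + 12 * k + 2) * o := by ring
  rw [h6]
  -- 24k² + 12k + 2 ≤ 38k² because k ≥ 1.
  exact Nat.mul_le_mul_right _ (by nlinarith)

end IsRounding

end Approximation

end Clustering

namespace WordRAM

/-! ### A program logic with running times. -/

section Logic

/-- The operations in exact arithmetic, without reduction modulo the word size. -/
def BinOp.val : BinOp → ℕ → ℕ → ℕ
  | .add, x, y => x + y
  | .sub, x, y => x - y
  | .mul, x, y => x * y
  | .div, x, y => x / y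
  | .mod, x, y => x % y
  | .lt, x, y => if x < y then 1 else 0
  | .eq, x, y => if x = y then 1 else 0

@[simp] theorem BinOp.val_add (x y : ℕ) : BinOp.add.val x y = x + y := rfl

@[simp] theorem BinOp.val_sub (x y : ℕ) : BinOp.sub.val x y = x - y := rfl

@[simp] theorem BinOp.val_mul (x y : ℕ) : BinOp.mul.val x y = x * y := rfl

@[simp] theorem BinOp.val_div (x y : ℕ) : BinOp.div.val x y = x / y := rfl

@[simp] theorem BinOp.val_mod (x y : ℕ) : BinOp.mod.val x y = x % y := rfl

@[simp] theorem BinOp.val_lt_eq_zero (x y : ℕ) : BinOp.lt.val x y = 0 ↔ y ≤ x := by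
  simp [BinOp.val]

@[simp] theorem BinOp.val_eq_eq_zero (x y : ℕ) : BinOp.eq.val x y = 0 ↔ x ≠ y := by
  simp [BinOp.val]

/-- The operation does not overflow. -/
def BinOp.Safe (W : ℕ) : BinOp → ℕ → ℕ → Prop
  | .add, x, y => x + y < W
  | .mul, x, y => x * y < W
  | _, _, _ => True

/-- The value of an expression in exact arithmetic, without reduction modulo the word size. -/
def Expr.val (s : State) : Expr → ℕ
  | .lit m => m
  | .reg r => s.reg r
  | .load a i => s.arr a (i.val s)
  | .bin op e₁ e₂ => op.val (e₁.val s) (e₂.val s)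

/-- No intermediate result overflows. -/
def Expr.Safe (W : ℕ) (s : State) : Expr → Prop
  | .lit m => m < W
  | .reg _ => True
  | .load _ i => i.Safe W s
  | .bin op e₁ e₂ => e₁.Safe W s ∧ e₂.Safe W s ∧ op.Safe W (e₁.val s) (e₂.val s)

theorem BinOp.eval_eq_val {w W x y : ℕ} {op : BinOp} (hW : 2 ^ w = W) (h : op.Safe W x y) :
    op.eval w x y = op.val x y := by
  subst hW
  cases op
  case add => exact Nat.mod_eq_of_lt h
  case mul => exact Nat.mod_eq_of_lt h
  all_goals rfl

theorem Expr.eval_eq_val {w W : ℕ} (hW : 2 ^ w = W) {s : State} {e : Expr} (h : e.Safe W s) :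
    e.eval w s = e.val s := by
  subst hW
  induction e with
  | lit m => exact Nat.mod_eq_of_lt h
  | reg r => rfl
  | load a i ih => exact congrArg (s.arr a) (ih h)
  | bin op e₁ e₂ ih₁ ih₂ =>
    simp only [Expr.eval, Expr.val, ih₁ h.1, ih₂ h.2.1, BinOp.eval_eq_val rfl h.2.2]

/-- The weakest precondition of a loop-free program. -/
def Program.wp (W : ℕ) : Program → (State → Prop) → State → Prop
  | .skip, Q, s => Q s
  | .assign r e, Q, s => e.Safe W s ∧ Q (s.setReg r (e.val s))
  | .store a i e, Q, s => i.Safe W s ∧ e.Safe W s ∧ Q (s.setArr a (i.val s) (e.val s))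
  | .seq p q, Q, s => p.wp W (q.wp W Q) s
  | .ite b p q, Q, s => b.Safe W s ∧ (b.val s ≠ 0 → p.wp W Q s) ∧ (b.val s = 0 → q.wp W Q s)
  | .while _ _, _, _ => False

/-- A bound for the running time of a loop-free program. -/
def Program.cost : Program → ℕ
  | .skip => 1
  | .assign _ e => e.cost + 1
  | .store _ i e => i.cost + e.cost + 1
  | .seq p q => p.cost + q.cost
  | .ite b p q => b.cost + 1 + max p.cost q.cost
  -- A dummy value: loops have weakest precondition `False`, so it never serves as a time bound.
  | .while _ _ => 0

/-- Started in `s`, the program `p` halts after at most `B` steps in a state that satisfies `Q`. -/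
def Total (w : ℕ) (p : Program) (s : State) (B : ℕ) (Q : State → Prop) : Prop :=
  ∃ t s', Runs w p s t s' ∧ t ≤ B ∧ Q s'

variable {w W : ℕ} {p q : Program} {s : State} {B B' : ℕ} {Q Q' : State → Prop}

theorem Total.mono (h : Total w p s B Q) (hB : B ≤ B') (hQ : ∀ s', Q s' → Q' s') :
    Total w p s B' Q' := by
  obtain ⟨t, s', h1, h2, h3⟩ := h
  exact ⟨t, s', h1, h2.trans hB, hQ _ h3⟩

theorem Total.seq (h : Total w p s B Q) (h' : ∀ s', Q s' → Total w q s' B' Q') :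
    Total w (.seq p q) s (B + B') Q' := by
  obtain ⟨t, s', h1, h2, h3⟩ := h
  obtain ⟨t', s'', h4, h5, h6⟩ := h' s' h3
  exact ⟨t + t', s'', .seq h1 h4, by omega, h6⟩

/-- The safety conditions collected by `wp` rule out overflow, so machine values agree with exact
ones and the program can be analysed over the natural numbers. -/
theorem total_of_wp (hW : 2 ^ w = W) : ∀ {p : Program} {s : State} {Q : State → Prop},
    p.wp W Q s → Total w p s p.cost Q
  | .skip, s, _, h => ⟨1, s, .skip s, le_rfl, h⟩
  | .assign r e, s, _, h => by
      refine ⟨_, _, .assign r e s, le_rfl, ?_⟩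
      rw [Expr.eval_eq_val hW h.1]
      exact h.2
  | .store a i e, s, _, h => by
      refine ⟨_, _, .store a i e s, le_rfl, ?_⟩
      rw [Expr.eval_eq_val hW h.1, Expr.eval_eq_val hW h.2.1]
      exact h.2.2
  | .seq p q, s, Q, h => (total_of_wp hW (p := p) h).seq fun _ h' => total_of_wp hW h'
  | .ite b p q, s, Q, h => by
      obtain ⟨h1, h2, h3⟩ := h
      by_cases hb : b.val s = 0
      · obtain ⟨t, s', h4, h5, h6⟩ := total_of_wp hW (h3 hb)
        refine ⟨_, s', .ite_false ((Expr.eval_eq_val hW h1).trans hb) h4, ?_, h6⟩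
        simp only [Program.cost]
        omega
      · obtain ⟨t, s', h4, h5, h6⟩ := total_of_wp hW (h2 hb)
        refine ⟨_, s', .ite_true ?_ h4, ?_, h6⟩
        · rwa [Expr.eval_eq_val hW h1]
        · simp only [Program.cost]
          omega

/-- The variant `m` bounds the number of iterations. Each pays for the test, the branch and the
body; the last summand is the final failing test. -/
theorem total_while (hW : 2 ^ w = W) {b : Expr} {I : State → Prop} (m : State → ℕ)
    (hb : ∀ s, I s → b.Safe W s)
    (step : ∀ s, I s → b.val s ≠ 0 → Total w p s B fun s' => I s' ∧ m s' < m s) :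
    ∀ s, I s → Total w (.while b p) s (m s * (b.cost + 1 + B) + (b.cost + 1))
      fun s' => I s' ∧ b.val s' = 0 := by
  suffices H : ∀ N s, m s ≤ N → I s → Total w (.while b p) s (m s * (b.cost + 1 + B) + (b.cost + 1))
      fun s' => I s' ∧ b.val s' = 0 from fun s => H _ s le_rfl
  intro N
  induction N with
  | zero =>
    intro s hm hI
    by_cases h : b.val s = 0
    · exact ⟨_, s, .while_false ((Expr.eval_eq_val hW (hb s hI)).trans h), by omega, hI, h⟩
    · obtain ⟨_, _, _, _, _, h'⟩ := step s hI h
      omega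
  | succ N ih =>
    intro s hm hI
    by_cases h : b.val s = 0
    · exact ⟨_, s, .while_false ((Expr.eval_eq_val hW (hb s hI)).trans h), by omega, hI, h⟩
    · obtain ⟨t, s', h1, h2, h3, h4⟩ := step s hI h
      obtain ⟨t', s'', h5, h6, h7⟩ := ih s' (by omega) h3
      refine ⟨_, s'', .while_true (by rwa [Expr.eval_eq_val hW (hb s hI)]) h1 h5, ?_, h7⟩
      have : (m s' + 1) * (b.cost + 1 + B) ≤ m s * (b.cost + 1 + B) :=
        Nat.mul_le_mul_right _ h4
      rw [add_mul, one_mul] at this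
      omega

/-- `for r in {0, …, n - 1}`, where register `0` holds `n`. -/
def forLoop (r : ℕ) (p : Program) : Program :=
  .seq (.assign r (.lit 0)) (.while (.bin .lt (.reg r) (.reg 0))
    (.seq p (.assign r (.bin .add (.reg r) (.lit 1)))))

@[simp] theorem State.setReg_reg (s : State) (r x r' : ℕ) :
    (s.setReg r x).reg r' = if r' = r then x else s.reg r' := by
  simp [State.setReg, Function.update_apply]

@[simp] theorem State.setReg_arr (s : State) (r x : ℕ) : (s.setReg r x).arr = s.arr := rfl

@[simp] theorem State.setArr_reg (s : State) (a i x : ℕ) : (s.setArr a i x).reg = s.reg := rfl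

@[simp] theorem State.setArr_arr (s : State) (a i x a' : ℕ) :
    (s.setArr a i x).arr a' = if a' = a then Function.update (s.arr a) i x else s.arr a' := by
  simp [State.setArr, Function.update_apply]

/-- The 8 is test plus increment, the 6 is initialization plus last test. The invariant is required
of the state with the counter already advanced, as this is the state in which the next test happens.
-/
theorem total_forLoop (hW : 2 ^ w = W) {r n : ℕ} (hr : r ≠ 0) (hn : n + 1 < W) {I : ℕ → State → Prop}
    (step : ∀ i s, i < n → s.reg 0 = n → s.reg r = i → I i s → Total w p s B
      fun s' => s'.reg 0 = n ∧ s'.reg r = i ∧ I (i + 1) (s'.setReg r (i + 1)))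
    {s : State} (h0 : s.reg 0 = n) (hI : I 0 (s.setReg r 0)) :
    Total w (forLoop r p) s (n * (B + 8) + 6) fun s' => s'.reg 0 = n ∧ I n s' := by
  have h1 : Total w (.assign r (.lit 0)) s 2 fun s' =>
      s'.reg 0 = n ∧ s'.reg r = 0 ∧ I 0 s' := by
    refine total_of_wp hW (p := .assign r (.lit 0)) ?_
    refine ⟨by simp only [Expr.Safe]; omega, ?_⟩
    simp only [Expr.val]
    simp [hr.symm, h0, hI]
  have h2 : ∀ s', s'.reg 0 = n ∧ s'.reg r = 0 ∧ I 0 s' → Total w (.while (.bin .lt (.reg r)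
      (.reg 0)) (.seq p (.assign r (.bin .add (.reg r) (.lit 1))))) s' (n * (B + 8) + 4)
      fun s' => s'.reg 0 = n ∧ I n s' := by
    intro s' hs'
    refine (total_while hW (B := B + 4) (I := fun s => s.reg 0 = n ∧ s.reg r ≤ n ∧ I (s.reg r) s)
      (fun s => n - s.reg r) (fun s _ => by simp [Expr.Safe, BinOp.Safe]) ?_ s'
      ⟨hs'.1, by omega, by rw [hs'.2.1]; exact hs'.2.2⟩).mono ?_ ?_
    rotate_left
    · simp only [hs'.2.1, Expr.cost, Nat.sub_zero]
      exact le_of_eq (by ring)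
    · rintro s' ⟨⟨h5, h6, h7⟩, h8⟩
      refine ⟨h5, ?_⟩
      simp only [Expr.val, BinOp.val_lt_eq_zero] at h8
      rwa [show s'.reg r = n by omega] at h7
    · rintro s ⟨h3, h4, h5⟩ h6
      simp only [Expr.val, ne_eq, BinOp.val_lt_eq_zero, not_le] at h6
      refine (step _ s (by omega) h3 rfl h5).seq (B' := 4) fun s' hs' => ?_
      refine total_of_wp hW (p := .assign r (.bin .add (.reg r) (.lit 1))) ?_
      obtain ⟨h7, h8, h9⟩ := hs'
      refine ⟨⟨trivial, ?_, ?_⟩, ?_⟩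
      · simp only [Expr.Safe]; omega
      · simp only [Expr.val, BinOp.Safe]; omega
      · simp only [Expr.val, BinOp.val_add, h8]
        refine ⟨⟨?_, ?_, ?_⟩, ?_⟩
        · simp [hr.symm, h7]
        · simp only [State.setReg_reg, if_true]; omega
        · simpa using h9
        · simp only [State.setReg_reg, if_true]; omega
  exact (h1.seq h2).mono (by omega) fun _ h => h

end Logic

end WordRAM

/-! ### Tallies and the counting pass. -/

/-- The number of `x < v` with `f x = j`. -/
def tally (f : ℕ → ℕ) (v j : ℕ) : ℕ := Nat.count (fun x => f x = j) v

/-- The number of `x < v` with `f x = j` that satisfy `P`. -/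
def tallyIf (P : ℕ → Prop) [DecidablePred P] (f : ℕ → ℕ) (v j : ℕ) : ℕ :=
  Nat.count (fun x => P x ∧ f x = j) v

section Tally

variable {f : ℕ → ℕ} {v j : ℕ} {P : ℕ → Prop} [DecidablePred P]

theorem tally_zero : tally f 0 = fun _ => 0 := rfl

theorem tally_le : tally f v j ≤ v := Nat.count_le _

theorem tallyIf_le : tallyIf P f v j ≤ v := Nat.count_le _

theorem update_tally :
    Function.update (tally f v) (f v) (tally f v (f v) + 1) = tally f (v + 1) := by
  funext j
  rw [Function.update_apply]
  split_ifs with h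
  · subst h; simp [tally, Nat.count_succ]
  · simp [tally, Nat.count_succ, Ne.symm h]

theorem update_tallyIf (h : P v) :
    Function.update (tallyIf P f v) (f v) (tallyIf P f v (f v) + 1) = tallyIf P f (v + 1) := by
  funext j
  rw [Function.update_apply]
  split_ifs with h'
  · subst h'; simp [tallyIf, Nat.count_succ, h]
  · simp [tallyIf, Nat.count_succ, Ne.symm h']

theorem tallyIf_succ_of_not (h : ¬ P v) : tallyIf P f (v + 1) = tallyIf P f v := by
  funext j
  simp [tallyIf, Nat.count_succ, h]

theorem tally_lt_of_lt {n : ℕ} (h : v < n) : tally f v (f v) < tally f n (f v) :=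
  Nat.count_strict_mono rfl h

end Tally

namespace WordRAM

/-- The input is still in place. -/
def State.HasInput (n k : ℕ) (col lab : ℕ → ℕ) (s : State) : Prop :=
  s.reg 0 = n ∧ s.reg 1 = k ∧ s.arr 0 = col ∧ s.arr 1 = lab

/-- The arrays from number `a` on are blank. -/
def State.BlankFrom (a : ℕ) (s : State) : Prop := ∀ b, a ≤ b → s.arr b = fun _ => 0

theorem State.BlankFrom.mono {a b : ℕ} {s : State} (h : s.BlankFrom a) (hab : a ≤ b) :
    s.BlankFrom b := fun c hc => h c (hab.trans hc)

theorem State.BlankFrom.setReg {a r x : ℕ} {s : State} (h : s.BlankFrom a) :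
    (s.setReg r x).BlankFrom a := h

theorem State.BlankFrom.setArr {a b i x : ℕ} {s : State} (h : s.BlankFrom a) (hb : b < a) :
    (s.setArr b i x).BlankFrom a := fun c hc => by
  rw [State.setArr_arr, if_neg (by omega)]; exact h c hc

/-- Increment an array entry. -/
def incr (a : ℕ) (i : Expr) : Program := .store a i (.bin .add (.load a i) (.lit 1))

/-- Count the colors in array `3` and the labels in array `4`. -/
def countProgram : Program :=
  forLoop 2 (.seq (incr 3 (.load 0 (.reg 2))) (incr 4 (.load 1 (.reg 2))))

section

variable {w W n k : ℕ} {col lab : ℕ → ℕ} {s : State}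

theorem total_countProgram (hW : 2 ^ w = W) (hn : n + 1 < W) (h : s.HasInput n k col lab)
    (hs : s.BlankFrom 3) :
    Total w countProgram s (n * 24 + 6) fun s => s.HasInput n k col lab ∧
      s.arr 3 = tally col n ∧ s.arr 4 = tally lab n ∧ s.BlankFrom 5 := by
  obtain ⟨h0, h1, h2, h3⟩ := h
  refine (total_forLoop hW (B := 16) (by norm_num) hn
    (I := fun v s => s.HasInput n k col lab ∧
      s.arr 3 = tally col v ∧ s.arr 4 = tally lab v ∧ s.BlankFrom 5) ?_ h0 ?_).mono
    (by omega) fun s hs => hs.2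
  · rintro v s hv - hr ⟨⟨h0, h1, h2, h3⟩, h4, h5, h6⟩
    refine (total_of_wp hW ?_).mono (by simp [Program.cost, incr, Expr.cost]) fun _ h => h
    have h7 := @tally_le col v (col v)
    have h8 := @tally_le lab v (lab v)
    simp [Program.wp, incr, Expr.Safe, Expr.val, BinOp.Safe, State.HasInput, h0, h1, h2, h3, h4,
      h5, hr, update_tally]
    exact ⟨by omega, by omega, ((h6.setArr (by norm_num)).setArr (by norm_num)).setReg⟩
  · exact ⟨⟨by simpa, by simpa, h2, h3⟩, hs 3 le_rfl, hs 4 (by norm_num),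
      (hs.mono (by norm_num)).setReg⟩

end

end WordRAM

/-! ### The most frequent colour and the gcd of the frequencies. -/

namespace WordRAM

/-- Euclid's algorithm for registers `9` and `10`; the result is in register `9`. -/
def euclidProgram : Program :=
  .while (.reg 10) (.seq (.assign 11 (.bin .mod (.reg 9) (.reg 10)))
    (.seq (.assign 9 (.reg 10)) (.assign 10 (.reg 11))))

/-- A most frequent color goes to register `4`, its frequency to register `3`, the greatest common
divisor of all frequencies to register `5`, and the quotient of the latter two to register `6`. -/
def selectProgram : Program :=
  .seq (.seq (.assign 3 (.lit 0)) (.seq (.assign 4 (.lit 0)) (.assign 5 (.lit 0))))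
    (.seq
      (forLoop 2 (.seq
        (.seq
          (.ite (.bin .lt (.reg 3) (.load 3 (.load 0 (.reg 2))))
            (.seq (.assign 3 (.load 3 (.load 0 (.reg 2)))) (.assign 4 (.load 0 (.reg 2)))) .skip)
          (.seq (.assign 9 (.load 3 (.load 0 (.reg 2)))) (.assign 10 (.bin .mod (.reg 5) (.reg 9)))))
        (.seq euclidProgram (.assign 5 (.reg 9)))))
      (.assign 6 (.bin .div (.reg 3) (.reg 5))))

section

variable {w W n k : ℕ} {col lab : ℕ → ℕ} {s : State}

/-- From 2(a mod b) ≤ a, one Euclidean step at least halves the product of the two numbers. The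
binary length of the product is thus a variant, which makes the gcd logarithmic. -/
theorem size_mul_mod_lt {a b : ℕ} (h : b ≤ a) (hb : b ≠ 0) :
    (b * (a % b)).size < (a * b).size := by
  have h1 : 2 * (a % b) ≤ a := by
    have h2 := Nat.mod_lt a (Nat.pos_of_ne_zero hb)
    have h3 := Nat.div_add_mod a b
    have h4 : 1 ≤ a / b := (Nat.one_le_div_iff (Nat.pos_of_ne_zero hb)).2 h
    have h5 : b * 1 ≤ b * (a / b) := Nat.mul_le_mul_left b h4
    omega
  have h0 : 0 < a * b := Nat.mul_pos (by omega) (by omega)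
  have h6 : 0 < (a * b).size := Nat.size_pos.2 h0
  suffices (b * (a % b)).size ≤ (a * b).size - 1 by omega
  rw [Nat.size_le]
  have h7 := Nat.lt_size_self (a * b)
  have h8 : 2 ^ (a * b).size = 2 * 2 ^ ((a * b).size - 1) := by
    rw [← pow_succ']; congr 1; omega
  have h9 : 2 * (b * (a % b)) ≤ a * b := by nlinarith
  omega

theorem size_mul_le (a b : ℕ) : (a * b).size ≤ a.size + b.size := by
  rw [Nat.size_le, pow_add]
  exact Nat.mul_lt_mul'' (Nat.lt_size_self a) (Nat.lt_size_self b)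

theorem total_euclidProgram (hW : 2 ^ w = W) (h : s.reg 10 ≤ s.reg 9) (hn : s.reg 9 ≤ n) :
    Total w euclidProgram s (n.size * 20 + 2) fun s' => s'.arr = s.arr ∧
      (∀ r < 9, s'.reg r = s.reg r) ∧ s'.reg 9 = Nat.gcd (s.reg 9) (s.reg 10) := by
  refine (total_while hW (B := 8) (I := fun s' => s'.arr = s.arr ∧ (∀ r < 9, s'.reg r = s.reg r) ∧
    s'.reg 10 ≤ s'.reg 9 ∧ Nat.gcd (s'.reg 9) (s'.reg 10) = Nat.gcd (s.reg 9) (s.reg 10))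
    (fun s => (s.reg 9 * s.reg 10).size) (fun _ _ => by simp [Expr.Safe]) ?_ s
    ⟨rfl, fun _ _ => rfl, h, rfl⟩).mono ?_ ?_
  · rintro s' ⟨h1, h2, h3, h4⟩ h5
    simp only [Expr.val] at h5
    refine (total_of_wp hW ?_).mono (by simp [Program.cost, Expr.cost]) fun _ h => h
    simp [-Order.lt_add_one_iff, Program.wp, Expr.Safe, Expr.val, BinOp.Safe, h1]
    refine ⟨⟨fun r hr => ?_, (Nat.mod_lt _ (Nat.pos_of_ne_zero h5)).le, ?_⟩, size_mul_mod_lt h3 h5⟩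
    · rw [if_neg (by omega), if_neg (by omega), if_neg (by omega), h2 r hr]
    · rw [← h4, Nat.gcd_comm, ← Nat.gcd_rec, Nat.gcd_comm]
  · have h6 := size_mul_le (s.reg 9) (s.reg 10)
    have h7 := Nat.size_le_size hn
    have h8 := Nat.size_le_size (h.trans hn)
    simp only [Expr.cost]
    omega
  · rintro s' ⟨⟨h1, h2, h3, h4⟩, h5⟩
    simp only [Expr.val] at h5
    rw [h5, Nat.gcd_zero_right] at h4
    exact ⟨h1, h2, h4⟩

/-- `m` is a most frequent color and `g` the greatest common divisor of the frequencies. -/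
structure IsSelection (n : ℕ) (col : ℕ → ℕ) (m g : ℕ) : Prop where
  le_max : ∀ x < n, tally col n (col x) ≤ tally col n m
  exists_eq : 0 < n → ∃ x < n, m = col x
  dvd : ∀ x < n, g ∣ tally col n (col x)
  dvd_of : ∀ d, (∀ x < n, d ∣ tally col n (col x)) → d ∣ g

/-- The loop runs over points instead of colours: absent colours affect neither maximum nor gcd, and
the time stays independent of `k`. In the invariant the case `v = 0` stands for no colour having
been seen yet. -/
theorem total_selectProgram (hW : 2 ^ w = W) (hn : n + 1 < W) (h : s.HasInput n k col lab)
    (h3 : s.arr 3 = tally col n) (h4 : s.arr 4 = tally lab n) (hs : s.BlankFrom 5) :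
    Total w selectProgram s (n * (n.size * 20 + 34) + 16) fun s => s.HasInput n k col lab ∧
      s.arr 4 = tally lab n ∧ s.BlankFrom 5 ∧
      ∃ m g, IsSelection n col m g ∧ s.reg 4 = m ∧ s.reg 5 = g ∧
        s.reg 6 = tally col n m / g := by
  obtain ⟨i0, i1, i2, i3⟩ := h
  refine (Total.seq (total_of_wp hW (Q := fun s => s.HasInput n k col lab ∧
      s.arr 3 = tally col n ∧ s.arr 4 = tally lab n ∧ s.BlankFrom 5 ∧ s.reg 3 = 0 ∧ s.reg 4 = 0 ∧
      s.reg 5 = 0) ?_) fun s hs => Total.seq (total_forLoop hW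
      (B := n.size * 20 + 26) (by norm_num) hn
      (I := fun v s => s.HasInput n k col lab ∧ s.arr 3 = tally col n ∧
        s.arr 4 = tally lab n ∧ s.BlankFrom 5 ∧
        ((v = 0 ∧ s.reg 3 = 0) ∨ (∃ x < v, s.reg 4 = col x) ∧ s.reg 3 = tally col n (s.reg 4)) ∧
        (∀ x < v, tally col n (col x) ≤ s.reg 3) ∧ (∀ x < v, s.reg 5 ∣ tally col n (col x)) ∧
        ∀ d, (∀ x < v, d ∣ tally col n (col x)) → d ∣ s.reg 5)
      ?_ hs.1.1 ?_) (B' := 4) fun s hs => ?_).mono (B := 6 + ((n * (n.size * 20 + 26 + 8) + 6) + 4))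
      ?_ fun _ h => h
  · simp [-Order.lt_add_one_iff, Program.wp, Expr.Safe, Expr.val, State.HasInput, i0, i1, i2, i3, h3, h4]
    exact ⟨by omega, hs⟩
  · rintro v s hv - hr ⟨⟨i0, i1, i2, i3⟩, h3, h4, h5, h6, h7, h8, h9⟩
    have hpos : 0 < tally col n (col v) := (Nat.zero_le _).trans_lt (tally_lt_of_lt hv)
    refine (Total.seq (total_of_wp hW (Q := fun s => s.HasInput n k col lab ∧
      s.arr 3 = tally col n ∧ s.arr 4 = tally lab n ∧ s.BlankFrom 5 ∧ s.reg 2 = v ∧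
      (∃ x < v + 1, s.reg 4 = col x) ∧ s.reg 3 = tally col n (s.reg 4) ∧
      (∀ x < v + 1, tally col n (col x) ≤ s.reg 3) ∧ (∀ x < v, s.reg 5 ∣ tally col n (col x)) ∧
      (∀ d, (∀ x < v, d ∣ tally col n (col x)) → d ∣ s.reg 5) ∧ s.reg 9 = tally col n (col v) ∧
      s.reg 10 = s.reg 5 % s.reg 9) ?_) (B' := n.size * 20 + 2 + 2) ?_).mono
        (by simp [Program.cost, Expr.cost]; omega) fun _ h => h
    · have h10 : ¬ s.reg 3 < tally col n (col v) → (∃ x < v + 1, s.reg 4 = col x) ∧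
          s.reg 3 = tally col n (s.reg 4) := by
        intro hlt
        rcases h6 with ⟨h61, h62⟩ | ⟨⟨x, hx, h61⟩, h62⟩
        · omega
        · exact ⟨⟨x, by omega, h61⟩, h62⟩
      have h11 : ∀ c, s.reg 3 ≤ c → tally col n (col v) ≤ c →
          ∀ x < v + 1, tally col n (col x) ≤ c := by
        intro c hc hc' x hx
        rcases Nat.lt_succ_iff_lt_or_eq.1 hx with h | rfl
        · exact (h7 x h).trans hc
        · exact hc'
      simp [-Order.lt_add_one_iff, Program.wp, Expr.Safe, Expr.val, BinOp.Safe, State.HasInput, i0, i1, i2, i3, h3, h4, hr]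
      refine ⟨fun hlt => ⟨h5, ⟨v, by omega, rfl⟩, h11 _ hlt.le le_rfl, h8, h9⟩, fun hle => ?_⟩
      exact ⟨h5, (h10 (by omega)).1, (h10 (by omega)).2, h11 _ le_rfl hle, h8, h9⟩
    · rintro s ⟨⟨i0, i1, i2, i3⟩, h3, h4, h5, hr, h6, h6', h7, h8, h9, h10, h11⟩
      refine (total_euclidProgram hW (n := n) ?_ (h10 ▸ tally_le)).seq fun s' hs' => ?_
      -- The old gcd is reduced modulo the positive frequency before the loop starts, which puts the
      -- larger number first.
      · rw [h11]; exact (Nat.mod_lt _ (by omega)).le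
      · obtain ⟨j1, j2, j3⟩ := hs'
        refine (total_of_wp hW ?_).mono (by simp [Program.cost, Expr.cost]) fun _ h => h
        rw [h11, Nat.gcd_comm, ← Nat.gcd_rec, h10] at j3
        simp [-Order.lt_add_one_iff, Program.wp, Expr.Safe, Expr.val, State.HasInput, j1, j2, i0, i1, i2, i3, h3, h4, hr,
          h6', j3]
        rw [h6'] at h7
        refine ⟨?_, h6, h7, ?_, ?_⟩
        · intro b hb
          rw [State.setReg_arr, State.setReg_arr, j1]
          exact h5 b hb
        · intro x hx
          rcases Nat.lt_succ_iff_lt_or_eq.1 hx with h | rfl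
          · exact (Nat.gcd_dvd_right _ _).trans (h8 x h)
          · exact Nat.gcd_dvd_left _ _
        · intro d hd
          exact Nat.dvd_gcd (hd v (by omega)) (h9 d fun x hx => hd x (by omega))
  · obtain ⟨⟨i0, i1, i2, i3⟩, h3, h4, h5, h6, h7, h8⟩ := hs
    refine ⟨⟨by simpa, by simpa, i2, i3⟩, h3, h4, h5, Or.inl ⟨rfl, by simpa⟩, ?_, ?_, ?_⟩
    · intro x hx; omega
    · intro x hx; omega
    · intro d _; simp [h8]
  · obtain ⟨-, ⟨i0, i1, i2, i3⟩, h3, h4, h5, h6, h7, h8, h9⟩ := hs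
    refine (total_of_wp hW ?_).mono (by simp [Program.cost, Expr.cost]) fun _ h => h
    simp [-Order.lt_add_one_iff, Program.wp, Expr.Safe, Expr.val, BinOp.Safe, State.HasInput, i0, i1, i2, i3, h4]
    refine ⟨h5, ?_, ?_⟩
    · rcases h6 with ⟨h61, h62⟩ | ⟨⟨x, hx, h61⟩, h62⟩
      · subst h61
        exact ⟨by intro x hx; omega, by intro h; omega, h8, h9⟩
      · exact ⟨by rwa [h62] at h7, fun _ => ⟨x, hx, h61⟩, h8, h9⟩
    · rcases h6 with ⟨h61, h62⟩ | ⟨⟨x, hx, h61⟩, h62⟩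
      · subst h61; rw [h62]; simp [tally]
      · rw [h62]
  · exact le_of_eq (by ring)

end

end WordRAM

/-! ### Listing the units by increasing cluster size. -/

/-- The first `c` entries of `E` list labels in the order of increasing levels, where the level of
`i` is the binary length of `S i`. The label `i` occurs as often as the rounded quotient of `r i`
and `p` says. -/
structure IsEmission (n : ℕ) (S r : ℕ → ℕ) (p l c : ℕ) (E : ℕ → ℕ) : Prop where
  tally_eq : ∀ i, tally E c i = (r i + p / 2) / p
  lt : ∀ e < c, E e < n
  level_le : ∀ e < c, (S (E e)).size ≤ l
  sorted : ∀ e e', e < e' → e' < c → (S (E e)).size ≤ (S (E e')).size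

theorem tally_congr {f f' : ℕ → ℕ} {v : ℕ} (h : ∀ x < v, f x = f' x) (j : ℕ) :
    tally f v j = tally f' v j := by
  induction v with
  | zero => rfl
  | succ v ih =>
    have := ih fun x hx => h x (by omega)
    simp only [tally, Nat.count_succ, h v (by omega)] at this ⊢
    rw [this]

namespace IsEmission

variable {n : ℕ} {S r : ℕ → ℕ} {p l c : ℕ} {E : ℕ → ℕ}

theorem mono {l' : ℕ} (h : IsEmission n S r p l c E) (hl : l ≤ l') : IsEmission n S r p l' c E :=
  ⟨h.tally_eq, h.lt, fun e he => (h.level_le e he).trans hl, h.sorted⟩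

/-- The rounded quotient rises with a new point exactly when `p` divides the shifted count. Units
can therefore be emitted while points are counted, without a separate rounding pass. -/
theorem skip (h : IsEmission n S r p l c E) {i : ℕ} (hi : (r i + 1 + p / 2) % p ≠ 0) :
    IsEmission n S (Function.update r i (r i + 1)) p l c E := by
  refine ⟨fun j => ?_, h.lt, h.level_le, h.sorted⟩
  rw [h.tally_eq, Function.update_apply]
  split_ifs with hj
  · subst hj
    rw [show r j + 1 + p / 2 = r j + p / 2 + 1 by ring, Nat.succ_div, if_neg, add_zero]
    rw [Nat.dvd_iff_mod_eq_zero]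
    rwa [show r j + 1 + p / 2 = r j + p / 2 + 1 by ring] at hi
  · rfl

theorem push (h : IsEmission n S r p l c E) {i : ℕ} (hi : (r i + 1 + p / 2) % p = 0)
    (hn : i < n) (hl : (S i).size = l) :
    IsEmission n S (Function.update r i (r i + 1)) p l (c + 1) (Function.update E c i) := by
  have hE : ∀ e < c, Function.update E c i e = E e := fun e he =>
    Function.update_of_ne (by omega) _ _
  refine ⟨fun j => ?_, fun e he => ?_, fun e he => ?_, fun e e' he he' => ?_⟩
  · have h1 : tally (Function.update E c i) c j = tally E c j := tally_congr hE j
    have h2 := h.tally_eq j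
    rw [show r i + 1 + p / 2 = r i + p / 2 + 1 by ring, ← Nat.dvd_iff_mod_eq_zero] at hi
    unfold tally at h1 h2 ⊢
    rw [Nat.count_succ, h1, h2, Function.update_self, Function.update_apply]
    by_cases hj : j = i
    · subst hj
      rw [if_pos rfl, if_pos rfl, show r j + 1 + p / 2 = r j + p / 2 + 1 by ring, Nat.succ_div,
        if_pos hi]
    · rw [if_neg hj, if_neg (Ne.symm hj), add_zero]
  · rcases Nat.lt_succ_iff_lt_or_eq.1 he with h' | rfl
    · rw [hE e h']; exact h.lt e h'
    · rwa [Function.update_self]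
  · rcases Nat.lt_succ_iff_lt_or_eq.1 he with h' | rfl
    · rw [hE e h']; exact h.level_le e h'
    · rw [Function.update_self, hl]
  · rw [hE e (by omega)]
    rcases Nat.lt_succ_iff_lt_or_eq.1 he' with h' | rfl
    · rw [hE e' h']; exact h.sorted e e' he h'
    · rw [Function.update_self, hl]; exact h.level_le e he

end IsEmission

/-- This lets the program recognize a binary length by one division. -/
theorem div_two_pow_eq_one_iff {a l : ℕ} : a / 2 ^ l = 1 ↔ a.size = l + 1 := by
  have h1 : a.size = l + 1 ↔ l < a.size ∧ a.size ≤ l + 1 := by omega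
  rw [h1, Nat.lt_size, Nat.size_le, Nat.div_eq_iff (by positivity), pow_succ]
  have := Nat.one_le_two_pow (n := l)
  omega

namespace WordRAM

/-- List the labels as units in array `6`, smaller clusters first: cluster sizes are compared by
their binary length, which is one more than the logarithm of register `7`. Within each cluster the
points of the color in register `4` are counted. Register `8` holds the number of units. -/
def emitProgram : Program :=
  .seq (.seq (.assign 7 (.lit 1)) (.assign 8 (.lit 0)))
    (.seq
      (.while (.bin .lt (.reg 7) (.bin .add (.reg 0) (.lit 1)))
        (.seq
          (forLoop 2
            (.ite (.bin .eq (.load 0 (.reg 2)) (.reg 4))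
              (.ite (.bin .eq (.bin .div (.load 4 (.load 1 (.reg 2))) (.reg 7)) (.lit 1))
                (.seq (incr 5 (.load 1 (.reg 2)))
                  (.ite (.bin .mod (.bin .add (.load 5 (.load 1 (.reg 2)))
                      (.bin .div (.reg 6) (.lit 2))) (.reg 6)) .skip
                    (.seq (.store 6 (.reg 8) (.load 1 (.reg 2)))
                      (.assign 8 (.bin .add (.reg 8) (.lit 1))))))
                .skip)
              .skip))
          (.assign 7 (.bin .add (.reg 7) (.reg 7)))))
      (.assign 12 (.bin .sub (.reg 8) (.reg 5))))

section

variable {w W n k : ℕ} {col lab : ℕ → ℕ} {s : State}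

/-- The numbers of points of color `m` counted so far, when the levels up to `l` have been
completed and the first `v` points have been considered for level `l + 1`. -/
def levelTally (n : ℕ) (col lab : ℕ → ℕ) (m l v i : ℕ) : ℕ :=
  tallyIf (fun x => col x = m ∧ (tally lab n (lab x)).size ≤ l) lab n i +
    tallyIf (fun x => col x = m ∧ (tally lab n (lab x)).size = l + 1) lab v i

theorem levelTally_le {m l v i : ℕ} : levelTally n col lab m l v i ≤ n + v :=
  Nat.add_le_add tallyIf_le tallyIf_le

theorem update_levelTally {m l v : ℕ} (h : col v = m)
    (h' : (tally lab n (lab v)).size = l + 1) :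
    Function.update (levelTally n col lab m l v) (lab v) (levelTally n col lab m l v (lab v) + 1) =
      levelTally n col lab m l (v + 1) := by
  funext i
  unfold levelTally
  rw [← update_tallyIf (P := fun x => col x = m ∧ (tally lab n (lab x)).size = l + 1) ⟨h, h'⟩,
    Function.update_apply, Function.update_apply]
  split_ifs with hi
  · rw [hi, add_assoc]
  · rfl

theorem levelTally_succ_of_not {m l v : ℕ}
    (h : ¬ (col v = m ∧ (tally lab n (lab v)).size = l + 1)) :
    levelTally n col lab m l (v + 1) = levelTally n col lab m l v := by
  unfold levelTally
  rw [tallyIf_succ_of_not (P := fun x => col x = m ∧ (tally lab n (lab x)).size = l + 1) h]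

theorem levelTally_succ_level {m l : ℕ} :
    levelTally n col lab m (l + 1) 0 = levelTally n col lab m l n := by
  funext i
  unfold levelTally tallyIf
  rw [Nat.count_zero, add_zero]
  have : ∀ v, Nat.count (fun x => (col x = m ∧ (tally lab n (lab x)).size ≤ l + 1) ∧ lab x = i) v =
      Nat.count (fun x => (col x = m ∧ (tally lab n (lab x)).size ≤ l) ∧ lab x = i) v +
      Nat.count (fun x => (col x = m ∧ (tally lab n (lab x)).size = l + 1) ∧ lab x = i) v := by
    intro v
    induction v with
    | zero => rfl
    | succ v ih =>
      rw [Nat.count_succ, Nat.count_succ, Nat.count_succ, ih]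
      split_ifs <;> omega
  exact this n

theorem levelTally_zero {m : ℕ} : levelTally n col lab m 0 0 = fun _ => 0 := by
  funext i
  unfold levelTally tallyIf
  rw [Nat.count_zero, add_zero, Nat.count_iff_forall_not]
  rintro x hx ⟨⟨-, h⟩, -⟩
  have h1 := (Nat.zero_le _).trans_lt (tally_lt_of_lt (f := lab) hx)
  have h2 := Nat.size_pos.2 h1
  omega

theorem levelTally_size {m : ℕ} :
    levelTally n col lab m n.size 0 = tallyIf (fun x => col x = m) lab n := by
  funext i
  unfold levelTally tallyIf
  rw [Nat.count_zero, add_zero]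
  congr 1
  funext x
  have := Nat.size_le_size (tally_le (f := lab) (v := n) (j := lab x))
  simp [this]

/-- One linear pass per binary length replaces sorting. The crude bound of `n` units per pass
suffices to keep the list index within a word. -/
theorem total_emitProgram {m g : ℕ} (hW : 2 ^ w = W) (hn : n * n + 4 * n + 4 ≤ W)
    (h : s.HasInput n k col lab) (hlab : ∀ x < n, lab x < n)
    (h4 : s.arr 4 = tally lab n) (hs : s.BlankFrom 5)
    (hm : s.reg 4 = m) (hg : s.reg 5 = g) (hp : s.reg 6 = tally col n m / g) :
    Total w emitProgram s (n.size * (n * 48 + 16) + 14) fun s => s.HasInput n k col lab ∧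
      s.BlankFrom 7 ∧ s.reg 5 = g ∧ s.reg 12 = s.reg 8 - g ∧ s.reg 8 ≤ n * n ∧
      IsEmission n (tally lab n) (tallyIf (fun x => col x = m) lab n) (tally col n m / g) n.size
        (s.reg 8) (s.arr 6) := by
  obtain ⟨i0, i1, i2, i3⟩ := h
  have hpn : tally col n m / g ≤ n := (Nat.div_le_self _ _).trans tally_le
  generalize hpe : tally col n m / g = p at *
  have hsize : n.size ≤ n := Nat.size_le.2 Nat.lt_two_pow_self
  have inner : ∀ (l : ℕ) (s : State), l < n.size → s.reg 0 = n → s.reg 7 = 2 ^ l →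
      (s.HasInput n k col lab ∧ s.arr 4 = tally lab n ∧ s.BlankFrom 7 ∧ s.reg 4 = m ∧
        s.reg 5 = g ∧ s.reg 6 = p ∧ s.arr 5 = levelTally n col lab m l 0 ∧ s.reg 8 ≤ l * n ∧
        IsEmission n (tally lab n) (levelTally n col lab m l 0) p l (s.reg 8) (s.arr 6)) →
      Total w (forLoop 2
            (.ite (.bin .eq (.load 0 (.reg 2)) (.reg 4))
              (.ite (.bin .eq (.bin .div (.load 4 (.load 1 (.reg 2))) (.reg 7)) (.lit 1))
                (.seq (incr 5 (.load 1 (.reg 2)))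
                  (.ite (.bin .mod (.bin .add (.load 5 (.load 1 (.reg 2)))
                      (.bin .div (.reg 6) (.lit 2))) (.reg 6)) .skip
                    (.seq (.store 6 (.reg 8) (.load 1 (.reg 2)))
                      (.assign 8 (.bin .add (.reg 8) (.lit 1))))))
                .skip)
              .skip)) s (n * 48 + 6) fun s =>
        s.HasInput n k col lab ∧ s.arr 4 = tally lab n ∧ s.BlankFrom 7 ∧ s.reg 4 = m ∧
        s.reg 5 = g ∧ s.reg 6 = p ∧ s.reg 7 = 2 ^ l ∧ s.arr 5 = levelTally n col lab m (l + 1) 0 ∧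
        s.reg 8 ≤ (l + 1) * n ∧
        IsEmission n (tally lab n) (levelTally n col lab m (l + 1) 0) p (l + 1)
          (s.reg 8) (s.arr 6) := by
    rintro l s hl - h7 ⟨⟨i0, i1, i2, i3⟩, h4, hs, hm, hg, hp, h5, h8, h6⟩
    have hln : l * n + n ≤ n * n := by nlinarith
    refine (total_forLoop hW (B := 40) (by norm_num) (by omega)
      (I := fun v s => s.HasInput n k col lab ∧ s.arr 4 = tally lab n ∧ s.BlankFrom 7 ∧
        s.reg 4 = m ∧ s.reg 5 = g ∧ s.reg 6 = p ∧ s.reg 7 = 2 ^ l ∧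
        s.arr 5 = levelTally n col lab m l v ∧ s.reg 8 ≤ l * n + v ∧
        IsEmission n (tally lab n) (levelTally n col lab m l v) p (l + 1) (s.reg 8) (s.arr 6))
      ?_ i0 ?_).mono (by omega) ?_
    · rintro v s hv - hr ⟨⟨i0, i1, i2, i3⟩, h4, hs, hm, hg, hp, h7, h5, h8, h6⟩
      refine (total_of_wp hW ?_).mono (by simp [Program.cost, incr, Expr.cost]) fun _ h => h
      have h9 := levelTally_le (n := n) (col := col) (lab := lab) (m := m) (l := l) (v := v)
        (i := lab v)
      simp [-Order.lt_add_one_iff, Program.wp, incr, Expr.Safe, Expr.val, BinOp.Safe,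
        State.HasInput, i0, i1, i2, i3, h4, h5, h7, hr, hm, hp, hg, div_two_pow_eq_one_iff]
      refine ⟨fun hc => ⟨by omega, fun hl' => ?_, fun hl' => ?_⟩, fun hc => ?_⟩
      · have h10 := update_levelTally (n := n) hc hl'
        refine ⟨⟨by omega, by omega⟩, ⟨by omega, by omega⟩, fun hmod => ?_, fun hmod => ?_⟩
        · exact ⟨(hs.setArr (by norm_num)).setReg, h10, by omega, h10 ▸ h6.skip hmod⟩
        · exact ⟨⟨by omega, by omega⟩,
            (((hs.setArr (by norm_num)).setArr (by norm_num)).setReg).setReg, h10, by omega,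
            h10 ▸ h6.push hmod (hlab v hv) hl'⟩
      · have h10 := levelTally_succ_of_not (col := col) (m := m) (n := n) (l := l)
          fun h => hl' h.2
        rw [h10]
        exact ⟨hs, rfl, by omega, h6⟩
      · have h10 := levelTally_succ_of_not (lab := lab) (n := n) (l := l) fun h => hc h.1
        rw [h10]
        exact ⟨hs, rfl, by omega, h6⟩
    · exact ⟨⟨by simpa, by simpa, i2, i3⟩, h4, hs, by simpa, by simpa, by simpa, by simpa, h5,
        by simpa, h6.mono (by omega)⟩
    · rintro s ⟨-, i, h4, hs, hm, hg, hp, h7, h5, h8, h6⟩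
      rw [levelTally_succ_level]
      exact ⟨i, h4, hs, hm, hg, hp, h7, h5, by rw [add_mul, one_mul]; exact h8, h6⟩
  refine (Total.seq (total_of_wp hW (Q := fun s => s.HasInput n k col lab ∧
      s.arr 4 = tally lab n ∧ s.BlankFrom 5 ∧ s.reg 4 = m ∧
      s.reg 5 = g ∧ s.reg 6 = p ∧ s.reg 7 = 1 ∧ s.reg 8 = 0) ?_) fun s hs =>
    Total.seq (Total.mono (total_while hW (B := n * 48 + 10)
      (I := fun s => ∃ l ≤ n.size, s.HasInput n k col lab ∧ s.arr 4 = tally lab n ∧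
        s.BlankFrom 7 ∧ s.reg 4 = m ∧ s.reg 5 = g ∧ s.reg 6 = p ∧ s.reg 7 = 2 ^ l ∧
        s.arr 5 = levelTally n col lab m l 0 ∧ s.reg 8 ≤ l * n ∧
        IsEmission n (tally lab n) (levelTally n col lab m l 0) p l (s.reg 8) (s.arr 6))
      -- Register `7` is 2^l, of binary length l + 1, so the variant is the number of levels left.
      (fun s => n.size + 1 - (s.reg 7).size) ?_ ?_ s ?_) (B' := n.size * (n * 48 + 16) + 6)
      ?_ fun _ h => h) (B' := 4) fun s hs => ?_).mono
        (B := 4 + (n.size * (n * 48 + 16) + 6 + 4)) (by omega) fun _ h => h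
  · simp [Program.wp, Expr.Safe, Expr.val, State.HasInput, i0, i1, i2, i3, h4, hm, hg, hp]
    exact ⟨by omega, by omega, hs⟩
  · rintro s ⟨l, hl, ⟨i0, -⟩, -⟩
    simp only [Expr.Safe, BinOp.Safe, Expr.val, i0]
    refine ⟨trivial, ⟨trivial, by omega, by omega⟩, trivial⟩
  · rintro s ⟨l, hl, i, h4, hs, hm, hg, hp, h7, h5, h8, h6⟩ hb
    simp only [Expr.val, ne_eq, BinOp.val_lt_eq_zero, BinOp.val_add, i.1, h7, not_le,
      Nat.lt_succ_iff] at hb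
    have hl' : l < n.size := Nat.lt_size.2 hb
    refine (inner l s hl' i.1 h7 ⟨i, h4, hs, hm, hg, hp, h5, h8, h6⟩).seq (B' := 4)
      fun s' hs' => ?_
    obtain ⟨⟨i0, i1, i2, i3⟩, h4, hs, hm, hg, hp, h7', h5, h8, h6⟩ := hs'
    refine (total_of_wp hW ?_).mono (by simp [Program.cost, Expr.cost]) fun _ h => h
    simp only [Program.wp, Expr.Safe, Expr.val, BinOp.Safe, BinOp.val_add, h7', h7]
    refine ⟨⟨trivial, trivial, by omega⟩, ⟨l + 1, hl', ?_⟩, ?_⟩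
    · simp [State.HasInput, i0, i1, i2, i3, h4, hm, hg, hp, h5]
      exact ⟨hs, by ring, h8, h6⟩
    · rw [State.setReg_reg, if_pos rfl, ← two_mul, ← pow_succ', Nat.size_pow, Nat.size_pow]
      omega
  · obtain ⟨i, h4, hs, hm, hg, hp, h7, h8⟩ := hs
    refine ⟨0, by omega, i, h4, hs.mono (by norm_num), hm, hg, hp, by simpa using h7, ?_, by omega,
      ⟨fun j => ?_, fun e he => ?_, fun e he => ?_, fun e e' he he' => ?_⟩⟩
    · rw [hs 5 le_rfl, levelTally_zero]
    · rw [h8, levelTally_zero, zero_add, tally, Nat.count_zero]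
      -- For `p = 0` the quotient is 0 by the convention for division by zero.
      rcases Nat.eq_zero_or_pos p with h | h
      · simp [h]
      · rw [Nat.div_eq_of_lt (Nat.div_lt_self h (by norm_num))]
    · omega
    · omega
    · omega
  · obtain ⟨-, -, -, -, -, -, h7, -⟩ := hs
    simp only [h7, Expr.cost]
    rw [Nat.size_one]
    refine le_of_eq ?_
    rw [Nat.add_sub_cancel]
    ring
  · obtain ⟨⟨l, hl, ⟨i0, i1, i2, i3⟩, h4, hs, hm, hg, hp, h7, h5, h8, h6⟩, hb⟩ := hs
    simp only [Expr.val, BinOp.val_lt_eq_zero, BinOp.val_add, i0, h7] at hb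
    have hl' : l = n.size := by
      refine le_antisymm hl (Nat.size_le.2 (by omega))
    subst hl'
    rw [levelTally_size] at h6
    refine (total_of_wp hW ?_).mono (by simp [Program.cost, Expr.cost]) fun _ h => h
    simp [Program.wp, Expr.Safe, Expr.val, BinOp.Safe, State.HasInput, i0, i1, i2, i3, hg]
    exact ⟨hs, h8.trans (Nat.mul_le_mul_right _ hsize), h6⟩

end

end WordRAM

/-! ### Slots of units and the matching of points to slots. -/

/-- The label of the unit `u < g`, if the last `g` of the `c` units listed in `E` are used and
missing units become new clusters. -/
def unitLabel (n g c : ℕ) (E : ℕ → ℕ) (u : ℕ) : ℕ :=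
  if u + (c - g) < c then E (u + (c - g)) else n + u

/-- The points of each color are assigned cyclically to the `g` units. -/
def slotLabel (n g c : ℕ) (E col : ℕ → ℕ) (v : ℕ) : ℕ :=
  unitLabel n g c E (tally col v (col v) % g)

/-- A number for the pair that consists of the label and the color of `v`. -/
def pairCode (k : ℕ) (f col : ℕ → ℕ) (v : ℕ) : ℕ := f v * k + col v

/-- If the `x < n` with a given `A`-value are matched in increasing order with the `y < n` with
the same `B`-value, then `x` gets a partner. -/
def Matched (n : ℕ) (A B : ℕ → ℕ) (x : ℕ) : Prop := tally A x (A x) < tally B n (A x)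

instance (n : ℕ) (A B : ℕ → ℕ) : DecidablePred (Matched n A B) :=
  fun _ => inferInstanceAs (Decidable (_ < _))

theorem slotLabel_lt {n g c : ℕ} {E col : ℕ → ℕ} {v : ℕ} (hE : ∀ e < c, E e < n) (hg : 0 < g)
    (hgn : g ≤ n) : slotLabel n g c E col v < 2 * n := by
  unfold slotLabel unitLabel
  have := Nat.mod_lt (tally col v (col v)) hg
  split_ifs with h
  · have := hE _ h
    omega
  · omega

namespace WordRAM

/-- Assign to every point a slot, whose label goes to array `8`. Arrays `9` and `10` count the slots
and the points for every pair of a label and a color. -/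
def slotProgram : Program :=
  forLoop 2
    (.seq (.assign 9 (.bin .mod (.load 7 (.load 0 (.reg 2))) (.reg 5)))
    (.seq (incr 7 (.load 0 (.reg 2)))
    (.seq (.assign 10 (.bin .add (.reg 9) (.reg 12)))
    (.seq (.ite (.bin .lt (.reg 10) (.reg 8)) (.assign 11 (.load 6 (.reg 10)))
      (.assign 11 (.bin .add (.reg 0) (.reg 9))))
    (.seq (.store 8 (.reg 2) (.reg 11))
    (.seq (incr 9 (.bin .add (.bin .mul (.reg 11) (.reg 1)) (.load 0 (.reg 2))))
      (incr 10 (.bin .add (.bin .mul (.load 1 (.reg 2)) (.reg 1)) (.load 0 (.reg 2))))))))))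

/-- List the labels of the unmatched slots of each color in array `13`. -/
def freeProgram : Program :=
  forLoop 2
    (.seq (.assign 9 (.bin .add (.bin .mul (.load 8 (.reg 2)) (.reg 1)) (.load 0 (.reg 2))))
    (.seq (.ite (.bin .lt (.load 11 (.reg 9)) (.load 10 (.reg 9))) .skip
      (.seq (.store 13 (.bin .add (.bin .mul (.load 0 (.reg 2)) (.reg 0))
        (.load 12 (.load 0 (.reg 2)))) (.load 8 (.reg 2))) (incr 12 (.load 0 (.reg 2)))))
      (incr 11 (.reg 9))))

/-- Matched points keep their label, the others get the labels of the unmatched slots. -/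
def outputProgram : Program :=
  forLoop 2
    (.seq (.assign 9 (.bin .add (.bin .mul (.load 1 (.reg 2)) (.reg 1)) (.load 0 (.reg 2))))
    (.seq (.ite (.bin .lt (.load 14 (.reg 9)) (.load 9 (.reg 9)))
        (.store 2 (.reg 2) (.load 1 (.reg 2)))
        (.seq (.store 2 (.reg 2) (.load 13 (.bin .add (.bin .mul (.load 0 (.reg 2)) (.reg 0))
          (.load 15 (.load 0 (.reg 2)))))) (incr 15 (.load 0 (.reg 2)))))
      (incr 14 (.reg 9))))

section

variable {w W n k g c : ℕ} {col lab E sl A B : ℕ → ℕ} {s : State}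

/-- Slot labels stay below 2n, so pair codes stay below 2nk + k; this and the n² bound for the unit
list dictate the word size. The tables need no initialization because they start blank. -/
theorem total_slotProgram (hW : 2 ^ w = W) (hn : n * n + 2 * (n * k) + 4 * n + k + 4 ≤ W)
    (h : s.HasInput n k col lab) (hlab : ∀ x < n, lab x < n) (hcol : ∀ x < n, col x < k)
    (hs : s.BlankFrom 7) (hg : s.reg 5 = g) (hgn : 0 < n → 0 < g ∧ g ≤ n) (hc : s.reg 8 = c)
    (hcn : c ≤ n * n)
    (hd : s.reg 12 = c - g) (hE : s.arr 6 = E) (hEn : ∀ e < c, E e < n) :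
    Total w slotProgram s (n * 80 + 6) fun s => s.HasInput n k col lab ∧ s.BlankFrom 11 ∧
      (∀ x < n, s.arr 8 x = slotLabel n g c E col x) ∧
      s.arr 9 = tally (pairCode k (slotLabel n g c E col) col) n ∧
      s.arr 10 = tally (pairCode k lab col) n := by
  obtain ⟨i0, i1, i2, i3⟩ := h
  refine (total_forLoop hW (B := 72) (by norm_num) (by omega)
    (I := fun v s => s.HasInput n k col lab ∧ s.BlankFrom 11 ∧ s.reg 5 = g ∧ s.reg 8 = c ∧
      s.reg 12 = c - g ∧ s.arr 6 = E ∧ s.arr 7 = tally col v ∧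
      (∀ x < v, s.arr 8 x = slotLabel n g c E col x) ∧
      s.arr 9 = tally (pairCode k (slotLabel n g c E col) col) v ∧
      s.arr 10 = tally (pairCode k lab col) v) ?_ i0 ?_).mono (by omega) ?_
  · rintro v s hv - hr ⟨⟨i0, i1, i2, i3⟩, hs, hg, hc, hd, hE, h7, h8, h9, h10⟩
    refine (total_of_wp hW ?_).mono (by simp [Program.cost, incr, Expr.cost]) fun _ h => h
    obtain ⟨hg0, hgn⟩ := hgn (by omega)
    have j1 := slotLabel_lt (col := col) (v := v) hEn hg0 hgn
    have j2 := hlab v hv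
    have j3 := hcol v hv
    have j4 := Nat.mul_le_mul_right k j1.le
    have j5 := Nat.mul_le_mul_right k j2.le
    have j6 := Nat.mod_lt (tally col v (col v)) hg0
    have j7 := @tally_le col v (col v)
    have j8 := @tally_le (pairCode k (slotLabel n g c E col) col) v
      (slotLabel n g c E col v * k + col v)
    have j9 := @tally_le (pairCode k lab col) v (lab v * k + col v)
    have j10 : ∀ x < v + 1, Function.update (s.arr 8) v (slotLabel n g c E col v) x =
        slotLabel n g c E col x := by
      intro x hx
      rcases Nat.lt_succ_iff_lt_or_eq.1 hx with h | rfl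
      · rw [Function.update_of_ne (by omega), h8 x h]
      · rw [Function.update_self]
    have j11 := @update_tally (pairCode k (slotLabel n g c E col) col) v
    have j12 := @update_tally (pairCode k lab col) v
    rw [show 2 * n * k = 2 * (n * k) by ring] at j4
    simp only [show ∀ f, pairCode k f col v = f v * k + col v from fun _ => rfl] at j11 j12
    simp [-Order.lt_add_one_iff, Program.wp, incr, Expr.Safe, Expr.val, BinOp.Safe,
      State.HasInput, i0, i1, i2, i3, hg, hc, hd, hE, h7, h9, h10, hr, update_tally]
    refine ⟨⟨by omega, by omega⟩, by omega, fun hlt => ?_, fun hle => ?_⟩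
    · have e : slotLabel n g c E col v = E (tally col v (col v) % g + (c - g)) := if_pos hlt
      rw [e] at j1 j4 j8 j10 j11
      exact ⟨⟨by omega, by omega⟩, ⟨⟨by omega, by omega⟩, by omega, by omega⟩,
        ⟨by omega, by omega⟩, ⟨⟨by omega, by omega⟩, by omega, by omega⟩,
        ((((hs.setArr (b := 7) (by norm_num)).setArr (b := 8) (by norm_num)).setArr (b := 9)
          (by norm_num)).setArr (b := 10) (by norm_num)), j10, j11, j12⟩
    · have e : slotLabel n g c E col v = n + tally col v (col v) % g := if_neg (by omega)
      rw [e] at j1 j4 j8 j10 j11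
      exact ⟨by omega, ⟨by omega, by omega⟩, ⟨⟨by omega, by omega⟩, by omega, by omega⟩,
        ⟨by omega, by omega⟩, ⟨⟨by omega, by omega⟩, by omega, by omega⟩,
        ((((hs.setArr (b := 7) (by norm_num)).setArr (b := 8) (by norm_num)).setArr (b := 9)
          (by norm_num)).setArr (b := 10) (by norm_num)), j10, j11, j12⟩
  · exact ⟨⟨by simpa, by simpa, i2, i3⟩, (hs.mono (by norm_num)).setReg, by simpa, by simpa,
      by simpa, hE, hs 7 le_rfl, fun x hx => absurd hx (by omega), hs 9 (by norm_num),
      hs 10 (by norm_num)⟩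
  · rintro s ⟨-, i, hs, -, -, -, -, -, h8, h9, h10⟩
    exact ⟨i, hs, h8, h9, h10⟩

theorem total_freeProgram (hW : 2 ^ w = W) (hn : n * n + 2 * (n * k) + 4 * n + k + 4 ≤ W)
    (h : s.HasInput n k col lab) (hcol : ∀ x < n, col x < k) (hsl : ∀ x < n, sl x < 2 * n)
    (hs : s.BlankFrom 11) (h8 : ∀ x < n, s.arr 8 x = sl x)
    (h9 : s.arr 9 = tally (pairCode k sl col) n)
    (h10 : s.arr 10 = tally (pairCode k lab col) n) :
    Total w freeProgram s (n * 80 + 6) fun s => s.HasInput n k col lab ∧ s.BlankFrom 14 ∧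
      s.arr 9 = tally (pairCode k sl col) n ∧
      ∀ x < n, ¬ Matched n (pairCode k sl col) (pairCode k lab col) x →
        s.arr 13 (col x * n + tallyIf (fun x => ¬ Matched n (pairCode k sl col)
          (pairCode k lab col) x) col x (col x)) = sl x := by
  obtain ⟨i0, i1, i2, i3⟩ := h
  refine (total_forLoop hW (B := 72) (by norm_num) (by omega)
    (I := fun v s => s.HasInput n k col lab ∧ s.BlankFrom 14 ∧ (∀ x < n, s.arr 8 x = sl x) ∧
      s.arr 9 = tally (pairCode k sl col) n ∧ s.arr 10 = tally (pairCode k lab col) n ∧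
      s.arr 11 = tally (pairCode k sl col) v ∧
      s.arr 12 = tallyIf (fun x => ¬ Matched n (pairCode k sl col) (pairCode k lab col) x) col v ∧
      ∀ x < v, ¬ Matched n (pairCode k sl col) (pairCode k lab col) x →
        s.arr 13 (col x * n + tallyIf (fun x => ¬ Matched n (pairCode k sl col)
          (pairCode k lab col) x) col x (col x)) = sl x) ?_ i0 ?_).mono (by omega) ?_
  · rintro v s hv - hr ⟨⟨i0, i1, i2, i3⟩, hs, h8, h9, h10, h11, h12, h13⟩
    refine (total_of_wp hW ?_).mono (by simp [Program.cost, incr, Expr.cost]) fun _ h => h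
    set P : ℕ → Prop := fun x => ¬ Matched n (pairCode k sl col) (pairCode k lab col) x with hP
    have j1 := hsl v hv
    have j3 := hcol v hv
    have j4 := Nat.mul_le_mul_right k j1.le
    have j5 := Nat.mul_le_mul_right n j3.le
    have j7 := @tallyIf_le col v (col v)
      (fun x => ¬ Matched n (pairCode k sl col) (pairCode k lab col) x) _
    have j8 := @tally_le (pairCode k sl col) v (sl v * k + col v)
    have j11 := @update_tally (pairCode k sl col) v
    rw [show 2 * n * k = 2 * (n * k) by ring] at j4
    rw [mul_comm k n] at j5
    have j12 : P v → ∀ x < v + 1, P x → Function.update (s.arr 13)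
        (col v * n + tallyIf P col v (col v)) (sl v) (col x * n + tallyIf P col x (col x)) =
        sl x := by
      intro hv' x hx hx'
      rcases Nat.lt_succ_iff_lt_or_eq.1 hx with h | rfl
      · rw [Function.update_of_ne, h13 x h hx']
        intro heq
        have k1 : tallyIf P col v (col v) < n := tallyIf_le.trans_lt hv
        have k2 : tallyIf P col x (col x) < n := (tallyIf_le).trans_lt (by omega)
        -- Each colour owns a block of `n` cells and uses offsets below `n`, so blocks never
        -- overlap; within a block the ranks are distinct.
        have k3 : col x = col v := by
          have := congrArg (· / n) heq
          simp only [mul_comm _ n] at this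
          rwa [Nat.mul_add_div (by omega), Nat.mul_add_div (by omega), Nat.div_eq_of_lt k1,
            Nat.div_eq_of_lt k2] at this
        have k4 : tallyIf P col x (col x) < tallyIf P col v (col x) :=
          Nat.count_strict_mono ⟨hx', rfl⟩ h
        rw [k3] at heq k4
        omega
      · rw [Function.update_self]
    have j13 : tally (pairCode k sl col) v (sl v * k + col v) <
        tally (pairCode k lab col) n (sl v * k + col v) → ¬ P v := fun h => not_not.2 h
    have j14 : tally (pairCode k lab col) n (sl v * k + col v) ≤
        tally (pairCode k sl col) v (sl v * k + col v) → P v := fun h => not_lt.2 h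
    simp only [show ∀ f, pairCode k f col v = f v * k + col v from fun _ => rfl] at j11
    simp [-Order.lt_add_one_iff, Program.wp, incr, Expr.Safe, Expr.val, BinOp.Safe,
      State.HasInput, i0, i1, i2, i3, h8 v hv, h9, h10, h11, h12, hr, j11]
    refine ⟨⟨by omega, by omega⟩, fun hlt => ?_, fun hle => ?_⟩
    · refine ⟨⟨by omega, by omega⟩, hs.setArr (b := 11) (by norm_num), h8,
        (tallyIf_succ_of_not (j13 hlt)).symm, fun x hx hx' => ?_⟩
      rcases Nat.lt_succ_iff_lt_or_eq.1 hx with h | rfl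
      · exact h13 x h hx'
      · exact absurd hx' (j13 hlt)
    · exact ⟨⟨by omega, by omega⟩, ⟨by omega, by omega⟩, ⟨by omega, by omega⟩,
        ((hs.setArr (b := 13) (by norm_num)).setArr (b := 12) (by norm_num)).setArr (b := 11)
          (by norm_num), h8, update_tallyIf (j14 hle), j12 (j14 hle)⟩
  · exact ⟨⟨by simpa, by simpa, i2, i3⟩, (hs.mono (by norm_num)).setReg, h8, h9, h10, hs 11 le_rfl,
      hs 12 (by norm_num), fun x hx => absurd hx (by omega)⟩
  · rintro s ⟨-, i, hs, -, h9, -, -, -, h13⟩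
    exact ⟨i, hs, h9, h13⟩

theorem total_outputProgram {FR : ℕ → ℕ} (hW : 2 ^ w = W)
    (hn : n * n + 2 * (n * k) + 4 * n + k + 4 ≤ W)
    (h : s.HasInput n k col lab) (hlab : ∀ x < n, lab x < n) (hcol : ∀ x < n, col x < k)
    (hs : s.BlankFrom 14) (h9 : s.arr 9 = tally (pairCode k sl col) n) (h13 : s.arr 13 = FR) :
    Total w outputProgram s (n * 80 + 6) fun s => ∀ x < n, s.arr 2 x =
      if Matched n (pairCode k lab col) (pairCode k sl col) x then lab x else
        FR (col x * n + tallyIf (fun x => ¬ Matched n (pairCode k lab col)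
          (pairCode k sl col) x) col x (col x)) := by
  obtain ⟨i0, i1, i2, i3⟩ := h
  set out : ℕ → ℕ := fun x => if Matched n (pairCode k lab col) (pairCode k sl col) x then lab x
    else FR (col x * n + tallyIf (fun x => ¬ Matched n (pairCode k lab col)
      (pairCode k sl col) x) col x (col x)) with hout
  refine (total_forLoop hW (B := 72) (by norm_num) (by omega)
    (I := fun v s => s.HasInput n k col lab ∧ s.arr 9 = tally (pairCode k sl col) n ∧
      s.arr 13 = FR ∧ s.arr 14 = tally (pairCode k lab col) v ∧
      s.arr 15 = tallyIf (fun x => ¬ Matched n (pairCode k lab col) (pairCode k sl col) x) col v ∧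
      ∀ x < v, s.arr 2 x = out x) ?_ i0 ?_).mono (by omega) ?_
  · rintro v s hv - hr ⟨⟨i0, i1, i2, i3⟩, h9, h13, h14, h15, h2⟩
    refine (total_of_wp hW ?_).mono (by simp [Program.cost, incr, Expr.cost]) fun _ h => h
    set P : ℕ → Prop := fun x => ¬ Matched n (pairCode k lab col) (pairCode k sl col) x with hP
    have j1 := hlab v hv
    have j3 := hcol v hv
    have j4 := Nat.mul_le_mul_right k j1.le
    have j5 := Nat.mul_le_mul_right n j3.le
    have j7 := @tallyIf_le col v (col v)
      (fun x => ¬ Matched n (pairCode k lab col) (pairCode k sl col) x) _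
    have j8 := @tally_le (pairCode k lab col) v (lab v * k + col v)
    have j11 := @update_tally (pairCode k lab col) v
    rw [mul_comm k n] at j5
    have j10 : ∀ a, a = out v → ∀ x < v + 1, Function.update (s.arr 2) v a x = out x := by
      rintro a rfl x hx
      rcases Nat.lt_succ_iff_lt_or_eq.1 hx with h | rfl
      · rw [Function.update_of_ne (by omega), h2 x h]
      · rw [Function.update_self]
    have j13 : tally (pairCode k lab col) v (lab v * k + col v) <
        tally (pairCode k sl col) n (lab v * k + col v) → ¬ P v := fun h => not_not.2 h
    have j14 : tally (pairCode k sl col) n (lab v * k + col v) ≤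
        tally (pairCode k lab col) v (lab v * k + col v) → P v := fun h => not_lt.2 h
    simp only [show ∀ f, pairCode k f col v = f v * k + col v from fun _ => rfl] at j11
    simp [-Order.lt_add_one_iff, Program.wp, incr, Expr.Safe, Expr.val, BinOp.Safe,
      State.HasInput, i0, i1, i2, i3, h9, h13, h14, h15, hr, j11]
    refine ⟨⟨by omega, by omega⟩, fun hlt => ?_, fun hle => ?_⟩
    · exact ⟨⟨by omega, by omega⟩, (tallyIf_succ_of_not (j13 hlt)).symm,
        j10 _ (if_pos (not_not.1 (j13 hlt))).symm⟩
    · exact ⟨⟨by omega, by omega⟩, ⟨by omega, by omega⟩, ⟨by omega, by omega⟩,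
        update_tallyIf (j14 hle), j10 _ (if_neg (j14 hle)).symm⟩
  · exact ⟨⟨by simpa, by simpa, i2, i3⟩, h9, h13, hs 14 le_rfl, hs 15 (by norm_num),
      fun x hx => absurd hx (by omega)⟩
  · rintro s ⟨-, -, -, -, -, -, h2⟩
    exact h2

end

end WordRAM

/-! ### Counting by ranks: correctness of the matching. -/

section Counting

theorem count_congr {p q : ℕ → Prop} [DecidablePred p] [DecidablePred q] {n : ℕ}
    (h : ∀ x < n, p x ↔ q x) : Nat.count p n = Nat.count q n :=
  le_antisymm (Nat.count_mono_left fun x hx => (h x hx).1)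
    (Nat.count_mono_left fun x hx => (h x hx).2)

/-- Counting by rank among the numbers that satisfy `p`. -/
theorem count_and_count (p q : ℕ → Prop) [DecidablePred p] [DecidablePred q] (n : ℕ) :
    Nat.count (fun x => p x ∧ q (Nat.count p x)) n = Nat.count q (Nat.count p n) := by
  induction n with
  | zero => simp
  | succ n ih =>
    rw [Nat.count_succ, ih, Nat.count_succ p]
    by_cases h : p n
    · simp [h, Nat.count_succ]
    · simp [h]

theorem count_and_add_count_and_not (p q : ℕ → Prop) [DecidablePred p] [DecidablePred q] (n : ℕ) :
    Nat.count (fun x => p x ∧ q x) n + Nat.count (fun x => p x ∧ ¬ q x) n = Nat.count p n := by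
  induction n with
  | zero => simp
  | succ n ih =>
    rw [Nat.count_succ, Nat.count_succ, Nat.count_succ, ← ih]
    by_cases h : p n <;> by_cases h' : q n <;> simp [h, h'] <;> omega

theorem count_mod_mul (q : ℕ → Prop) [DecidablePred q] (g a : ℕ) :
    Nat.count (fun x => q (x % g)) (g * a) = Nat.count q g * a := by
  induction a with
  | zero => simp
  | succ a ih =>
    rw [mul_add, mul_one, Nat.count_add, ih, mul_add, mul_one]
    congr 1
    refine count_congr fun x hx => ?_
    rw [Nat.mul_add_mod, Nat.mod_eq_of_lt hx]

theorem count_eq_sum_count (p : ℕ → Prop) [DecidablePred p] (f : ℕ → ℕ) {n M : ℕ}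
    (h : ∀ x < n, f x < M) :
    Nat.count p n = ∑ i ∈ Finset.range M, Nat.count (fun x => p x ∧ f x = i) n := by
  simp only [Nat.count_eq_card_filter_range]
  rw [Finset.card_eq_sum_card_fiberwise (f := f) (t := Finset.range M)]
  · refine Finset.sum_congr rfl fun i _ => ?_
    rw [Finset.filter_filter]
  · intro x hx
    have := (Finset.mem_filter.1 (Finset.mem_coe.1 hx)).1
    exact Finset.mem_coe.2 (Finset.mem_range.2 (h x (Finset.mem_range.1 this)))

theorem count_lt_eq_min (a b : ℕ) : Nat.count (fun x => x < a) b = min b a := by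
  induction b with
  | zero => simp
  | succ b ih => rw [Nat.count_succ, ih]; split_ifs <;> omega

/-- Whether `x` is matched depends only on its rank among the points with value `a`: the rank must
be below the number of partners. -/
theorem count_matched (n : ℕ) (A B : ℕ → ℕ) (a : ℕ) :
    Nat.count (fun x => A x = a ∧ Matched n A B x) n = min (tally A n a) (tally B n a) := by
  have h := count_and_count (fun x => A x = a) (fun r => r < tally B n a) n
  rw [count_lt_eq_min] at h
  refine Eq.trans (count_congr fun x _ => and_congr_right fun hx => ?_) h
  rw [Matched, hx]
  rfl

theorem pairCode_eq_iff {k i j : ℕ} {f col : ℕ → ℕ} {x : ℕ} (hx : col x < k) (hj : j < k) :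
    pairCode k f col x = i * k + j ↔ f x = i ∧ col x = j := by
  have hk : 0 < k := by omega
  unfold pairCode
  constructor
  · intro h
    have h1 := congrArg (· / k) h
    have h2 := congrArg (· % k) h
    simp only [mul_comm _ k, Nat.mul_add_div hk, Nat.div_eq_of_lt hx, Nat.div_eq_of_lt hj,
      Nat.mul_add_mod, Nat.mod_eq_of_lt hx, Nat.mod_eq_of_lt hj, add_zero] at h1 h2
    exact ⟨h1, h2⟩
  · rintro ⟨rfl, rfl⟩
    rfl

variable {n k : ℕ} {col lab sl out FR : ℕ → ℕ}

theorem tally_pairCode (hcol : ∀ x < n, col x < k) {i j : ℕ} (hj : j < k) :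
    tally (pairCode k lab col) n (i * k + j) = tallyIf (fun x => lab x = i) col n j :=
  count_congr fun x hx => pairCode_eq_iff (hcol x hx) hj

theorem tallyIf_matched (hcol : ∀ x < n, col x < k) {i j : ℕ} (hj : j < k) :
    Nat.count (fun x => (lab x = i ∧ col x = j) ∧
      Matched n (pairCode k lab col) (pairCode k sl col) x) n =
      min (tallyIf (fun x => lab x = i) col n j) (tallyIf (fun x => sl x = i) col n j) := by
  rw [← tally_pairCode hcol hj, ← tally_pairCode hcol hj, ← count_matched]
  exact count_congr fun x hx => and_congr_left fun _ => (pairCode_eq_iff (hcol x hx) hj).symm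

theorem tallyIf_not_matched (hcol : ∀ x < n, col x < k) {i j : ℕ} (hj : j < k) :
    Nat.count (fun x => (lab x = i ∧ col x = j) ∧
      ¬ Matched n (pairCode k lab col) (pairCode k sl col) x) n +
      min (tallyIf (fun x => lab x = i) col n j) (tallyIf (fun x => sl x = i) col n j) =
      tallyIf (fun x => lab x = i) col n j := by
  have h := count_and_add_count_and_not (fun x => lab x = i ∧ col x = j)
    (Matched n (pairCode k lab col) (pairCode k sl col)) n
  rw [tallyIf_matched hcol hj] at h
  rw [add_comm]
  exact h

/-- The numbers of unmatched points and of unmatched slots agree for every color. -/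
theorem tallyIf_not_matched_comm (hcol : ∀ x < n, col x < k) {M : ℕ} (hlab : ∀ x < n, lab x < M)
    (hsl : ∀ x < n, sl x < M) {j : ℕ} (hj : j < k) :
    tallyIf (fun x => ¬ Matched n (pairCode k lab col) (pairCode k sl col) x) col n j =
    tallyIf (fun x => ¬ Matched n (pairCode k sl col) (pairCode k lab col) x) col n j := by
  -- The unmatched points are the whole colour class minus a sum of minima, and that expression is
  -- symmetric in `lab` and `sl`.
  have key : ∀ lab sl : ℕ → ℕ, (∀ x < n, lab x < M) →
      tallyIf (fun x => ¬ Matched n (pairCode k lab col) (pairCode k sl col) x) col n j +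
      ∑ i ∈ Finset.range M, min (tallyIf (fun x => lab x = i) col n j)
        (tallyIf (fun x => sl x = i) col n j) = tally col n j := by
    intro lab sl hlab
    have h := count_and_add_count_and_not (fun x => col x = j)
      (Matched n (pairCode k lab col) (pairCode k sl col)) n
    rw [count_eq_sum_count (fun x => col x = j ∧
      Matched n (pairCode k lab col) (pairCode k sl col) x) lab hlab] at h
    rw [add_comm]
    refine Eq.trans (congrArg₂ _ (Finset.sum_congr rfl fun i _ => ?_) ?_) h
    · rw [← tallyIf_matched hcol hj]
      exact count_congr fun x _ => by tauto
    · exact count_congr fun x _ => by tauto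
  have h1 := key lab sl hlab
  have h2 := key sl lab hsl
  rw [Finset.sum_congr rfl fun i _ => min_comm _ _] at h2
  omega

/-- The output has as many points of color `j` and label `i` as there are slots. -/
theorem tallyIf_output (hcol : ∀ x < n, col x < k) {M : ℕ} (hlab : ∀ x < n, lab x < M)
    (hsl : ∀ x < n, sl x < M)
    (hFR : ∀ x < n, ¬ Matched n (pairCode k sl col) (pairCode k lab col) x →
      FR (col x * n + tallyIf (fun x => ¬ Matched n (pairCode k sl col)
        (pairCode k lab col) x) col x (col x)) = sl x)
    (hout : ∀ x < n, out x = if Matched n (pairCode k lab col) (pairCode k sl col) x then lab x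
      else FR (col x * n + tallyIf (fun x => ¬ Matched n (pairCode k lab col)
        (pairCode k sl col) x) col x (col x)))
    (i : ℕ) {j : ℕ} (hj : j < k) :
    tallyIf (fun x => out x = i) col n j = tallyIf (fun x => sl x = i) col n j ∧
    tallyIf (fun x => lab x = i ∧ out x = i) col n j =
      min (tallyIf (fun x => lab x = i) col n j) (tallyIf (fun x => sl x = i) col n j) := by
  set K := Matched n (pairCode k lab col) (pairCode k sl col) with hK
  set F := Matched n (pairCode k sl col) (pairCode k lab col) with hF
  -- The unmatched point of rank r in its colour receives the free slot of rank r. Both lists have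
  -- the same length, so all free slots are used once.
  have h1 : Nat.count (fun x => (¬ K x ∧ col x = j) ∧ out x = i) n =
      Nat.count (fun x => (sl x = i ∧ col x = j) ∧ ¬ F x) n := by
    have e1 := count_and_count (fun x => ¬ K x ∧ col x = j) (fun r => FR (j * n + r) = i) n
    have e2 := count_and_count (fun x => ¬ F x ∧ col x = j) (fun r => FR (j * n + r) = i) n
    have e3 : Nat.count (fun x => ¬ K x ∧ col x = j) n = Nat.count (fun x => ¬ F x ∧ col x = j) n :=
      tallyIf_not_matched_comm hcol hlab hsl hj
    rw [e3, ← e2] at e1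
    refine Eq.trans (count_congr fun x hx => and_congr_right fun hx' => ?_)
      (e1.trans (count_congr fun x hx => ?_))
    · rw [hout x hx, if_neg hx'.1, hx'.2]
      rfl
    · constructor
      · rintro ⟨⟨h1, rfl⟩, h2⟩
        exact ⟨⟨by rw [← h2]; exact (hFR x hx h1).symm, rfl⟩, h1⟩
      · rintro ⟨⟨rfl, rfl⟩, h1⟩
        exact ⟨⟨h1, rfl⟩, hFR x hx h1⟩
  have h2 : Nat.count (fun x => (sl x = i ∧ col x = j) ∧ ¬ F x) n +
      min (tallyIf (fun x => sl x = i) col n j) (tallyIf (fun x => lab x = i) col n j) =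
      tallyIf (fun x => sl x = i) col n j := tallyIf_not_matched hcol hj
  rw [← h1] at h2
  have h3 : Nat.count (fun x => (lab x = i ∧ col x = j) ∧ K x) n =
      min (tallyIf (fun x => lab x = i) col n j) (tallyIf (fun x => sl x = i) col n j) :=
    tallyIf_matched hcol hj
  have h4 : Nat.count (fun x => (lab x = i ∧ col x = j) ∧ ¬ K x) n +
      min (tallyIf (fun x => lab x = i) col n j) (tallyIf (fun x => sl x = i) col n j) =
      tallyIf (fun x => lab x = i) col n j := tallyIf_not_matched hcol hj
  have h5 := count_and_add_count_and_not (fun x => out x = i ∧ col x = j) K n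
  have h6 := count_and_add_count_and_not (fun x => (lab x = i ∧ out x = i) ∧ col x = j) K n
  have h7 : Nat.count (fun x => (out x = i ∧ col x = j) ∧ K x) n =
      Nat.count (fun x => (lab x = i ∧ col x = j) ∧ K x) n := by
    refine count_congr fun x hx => and_congr_left fun hx' => ?_
    rw [hout x hx, if_pos hx']
  have h8 : Nat.count (fun x => ((lab x = i ∧ out x = i) ∧ col x = j) ∧ K x) n =
      Nat.count (fun x => (lab x = i ∧ col x = j) ∧ K x) n := by
    refine count_congr fun x hx => and_congr_left fun hx' => ?_
    rw [hout x hx, if_pos hx', and_self]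
  have h9 : Nat.count (fun x => (out x = i ∧ col x = j) ∧ ¬ K x) n =
      Nat.count (fun x => (¬ K x ∧ col x = j) ∧ out x = i) n :=
    count_congr fun x _ => by tauto
  -- An unmatched point cannot regain its own label: for fixed label and colour, either no slot or
  -- no point is left over, so one of the next two bounds is 0.
  have h10 : Nat.count (fun x => ((lab x = i ∧ out x = i) ∧ col x = j) ∧ ¬ K x) n ≤
      Nat.count (fun x => (¬ K x ∧ col x = j) ∧ out x = i) n :=
    Nat.count_mono_left fun x _ => by tauto
  have h11 : Nat.count (fun x => ((lab x = i ∧ out x = i) ∧ col x = j) ∧ ¬ K x) n ≤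
      Nat.count (fun x => (lab x = i ∧ col x = j) ∧ ¬ K x) n :=
    Nat.count_mono_left fun x _ => by tauto
  change Nat.count (fun x => out x = i ∧ col x = j) n = tallyIf (fun x => sl x = i) col n j ∧
    Nat.count (fun x => (lab x = i ∧ out x = i) ∧ col x = j) n =
      min (tallyIf (fun x => lab x = i) col n j) (tallyIf (fun x => sl x = i) col n j)
  constructor <;> omega

/-- A cyclic assignment to `g` units goes round a whole number of times, since `g` divides the
frequency. Every unit thus gets the same number of points of colour `j`. -/
theorem tallyIf_slotLabel {g c : ℕ} {E : ℕ → ℕ} (i : ℕ) {j : ℕ} (hj : g ∣ tally col n j) :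
    tallyIf (fun x => slotLabel n g c E col x = i) col n j =
      tally (unitLabel n g c E) g i * (tally col n j / g) := by
  have h := count_and_count (fun x => col x = j) (fun r => unitLabel n g c E (r % g) = i) n
  have h2 := count_mod_mul (fun u => unitLabel n g c E u = i) g (tally col n j / g)
  rw [Nat.mul_div_cancel' hj] at h2
  refine Eq.trans (count_congr fun x _ => ?_) (h.trans h2)
  rw [and_comm]
  refine and_congr_right fun hx => ?_
  change unitLabel n g c E (tally col x (col x) % g) = i ↔ _
  rw [hx]
  rfl

end Counting

/-! ### Surviving, withdrawn and new units. -/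

section Units

variable {n g c : ℕ} {E : ℕ → ℕ}

/-- The units of an old cluster are the listed units except for the first `c - g`. -/
theorem tally_unitLabel {i : ℕ} (hi : i < n) :
    tally E c i = tally E (c - g) i + tally (unitLabel n g c E) g i := by
  unfold tally
  rcases le_total g c with h | h
  · have h1 := Nat.count_add (fun x => E x = i) (c - g) g
    rw [Nat.sub_add_cancel h] at h1
    rw [h1]
    congr 1
    refine count_congr fun u hu => ?_
    rw [unitLabel, if_pos (by omega), add_comm]
  · have h1 := Nat.count_add (fun u => unitLabel n g c E u = i) c (g - c)
    rw [Nat.add_sub_cancel' h] at h1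
    rw [h1, Nat.sub_eq_zero_of_le h, Nat.count_zero, zero_add,
      (Nat.count_iff_forall_not (p := fun u => unitLabel n g c E (c + u) = i)).2, add_zero]
    · refine count_congr fun u hu => ?_
      rw [unitLabel, Nat.sub_eq_zero_of_le h, add_zero, if_pos hu]
    · intro u _
      rw [unitLabel, if_neg (by omega)]
      omega

theorem tally_unitLabel_le_one (hE : ∀ e < c, E e < n) {i : ℕ} (hi : n ≤ i) :
    tally (unitLabel n g c E) g i ≤ 1 := by
  rw [tally, Nat.count_eq_card_filter_range, Finset.card_le_one]
  have h : ∀ u, unitLabel n g c E u = i → u = i - n := by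
    intro u hu
    rw [unitLabel] at hu
    split_ifs at hu with h
    · have := hE _ h
      omega
    · omega
  intro u hu v hv
  rw [h u (Finset.mem_filter.1 hu).2, h v (Finset.mem_filter.1 hv).2]

end Units

/-! ### From the arrays to a rounding of the clustering. -/

section Transfer

open Clustering

variable {n k : ℕ} {color : Fin n → Fin k} {col lab out : ℕ → ℕ}

theorem card_filter_fin (P : ℕ → Prop) [DecidablePred P] :
    (Finset.univ.filter fun v : Fin n => P v).card = Nat.count P n := by
  rw [Nat.count_eq_card_filter_range, ← Finset.card_map Fin.valEmbedding]
  congr 1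
  ext x
  simp only [Finset.mem_map, Finset.mem_filter, Finset.mem_univ, true_and, Fin.valEmbedding_apply,
    Finset.mem_range]
  constructor
  · rintro ⟨v, hv, rfl⟩
    exact ⟨v.2, hv⟩
  · rintro ⟨hx, hP⟩
    exact ⟨⟨x, hx⟩, hP, rfl⟩

theorem colorCount_filter (hcol : ∀ v : Fin n, col v = color v) (P : ℕ → Prop) [DecidablePred P]
    {S : Finset (Fin n)} (hS : ∀ v, v ∈ S ↔ P v) (j : Fin k) :
    colorCount color S j = tallyIf P col n j := by
  unfold colorCount tallyIf
  rw [← card_filter_fin]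
  congr 1
  ext v
  simp only [Finset.mem_filter, hS, Finset.mem_univ, true_and, hcol, Fin.ext_iff]

theorem isRounding_of_emission {g m c : ℕ} {E FR : ℕ → ℕ} (hn : 0 < n)
    (hcol : ∀ v : Fin n, col v = color v) (hlab : ∀ x < n, lab x < n)
    (hsel : WordRAM.IsSelection n col m g)
    (hE : IsEmission n (tally lab n) (tallyIf (fun x => col x = m) lab n) (tally col n m / g)
      n.size c E)
    (hFR : ∀ x < n, ¬ Matched n (pairCode k (slotLabel n g c E col) col) (pairCode k lab col) x →
      FR (col x * n + tallyIf (fun x => ¬ Matched n (pairCode k (slotLabel n g c E col) col)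
        (pairCode k lab col) x) col x (col x)) = slotLabel n g c E col x)
    (hout : ∀ x < n, out x = if Matched n (pairCode k lab col)
        (pairCode k (slotLabel n g c E col) col) x then lab x
      else FR (col x * n + tallyIf (fun x => ¬ Matched n (pairCode k lab col)
        (pairCode k (slotLabel n g c E col) col) x) col x (col x))) :
    ∃ (p : Fin k → ℕ) (mc : Fin k) (t' : ℕ → ℕ), IsRounding color (fun v => lab v)
      (fun v => out v) n g p mc t' := by
  have hcolk : ∀ x < n, col x < k := fun x hx => by
    rw [show col x = color ⟨x, hx⟩ from hcol ⟨x, hx⟩]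
    exact (color _).2
  obtain ⟨x₀, hx₀, hm⟩ := hsel.exists_eq hn
  have hpos : ∀ x < n, 0 < tally col n (col x) := fun x hx =>
    (Nat.zero_le _).trans_lt (tally_lt_of_lt hx)
  have hg : 0 < g := Nat.pos_of_dvd_of_pos (hsel.dvd x₀ hx₀) (hpos x₀ hx₀)
  have hgn : g ≤ n := (Nat.le_of_dvd (hpos x₀ hx₀) (hsel.dvd x₀ hx₀)).trans tally_le
  have hused : ∀ j, tally col n j = 0 ∨ ∃ x < n, j = col x := by
    intro j
    by_cases h : tally col n j = 0
    · exact Or.inl h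
    · obtain ⟨x, hx, h⟩ := Nat.count_ne_iff_exists.1 h
      exact Or.inr ⟨x, hx, h.symm⟩
  have hdvd : ∀ j, g ∣ tally col n j := by
    intro j
    rcases hused j with h | ⟨x, hx, rfl⟩
    · rw [h]; exact dvd_zero g
    · exact hsel.dvd x hx
  have hmax : ∀ j, tally col n j ≤ tally col n m := by
    intro j
    rcases hused j with h | ⟨x, hx, rfl⟩
    · omega
    · exact hsel.le_max x hx
  set sl := slotLabel n g c E col with hsl
  have hsl2 : ∀ x < n, sl x < 2 * n := fun x _ => slotLabel_lt hE.lt hg hgn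
  have hmk : m < k := hm ▸ hcolk x₀ hx₀
  have hfib : ∀ (f : ℕ → ℕ) (i : ℕ) (j : Fin k),
      colorCount color (fiber (fun v : Fin n => f v) i) j = tallyIf (fun x => f x = i) col n j :=
    fun f i j => colorCount_filter hcol _ (fun v => mem_fiber) j
  have hround : ∀ i, colorCount color (fiber (fun v : Fin n => lab v) i) ⟨m, hmk⟩ =
      tallyIf (fun x => col x = m) lab n i := by
    intro i
    rw [hfib lab]
    exact count_congr fun x _ => and_comm
  have hcard : ∀ i, (fiber (fun v : Fin n => lab v) i).card = tally lab n i := fun i =>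
    card_filter_fin (fun x => lab x = i)
  refine ⟨fun j => tally col n j / g, ⟨m, hmk⟩, tally (unitLabel n g c E) g,
    fun v => hlab v v.2, hg, ?_, ?_, ?_, ?_, ?_, ?_, ?_, ?_, ?_, ?_⟩
  · intro j
    rw [Nat.mul_div_cancel' (hdvd j), colorCount_filter hcol (fun _ => True) (by simp)]
    exact count_congr fun x _ => by simp
  · intro a ha
    -- A common divisor `a` of the reduced frequencies makes `a * g` a common divisor of the
    -- frequencies.
    have h1 : a * g ∣ g := by
      refine hsel.dvd_of _ fun x hx => ?_
      have h2 := Nat.mul_dvd_mul_right (ha ⟨col x, hcolk x hx⟩) g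
      rwa [Nat.div_mul_cancel (hdvd _)] at h2
    have h2 := Nat.le_of_dvd hg h1
    have h3 : a ≤ 1 := Nat.le_of_mul_le_mul_right (by rwa [one_mul]) hg
    have h4 : a ≠ 0 := by
      rintro rfl
      rw [zero_mul, zero_dvd_iff] at h1
      omega
    omega
  · exact fun j => Nat.div_le_div_right (hmax j)
  · exact Nat.div_pos (Nat.le_of_dvd (hm ▸ hpos x₀ hx₀) (hdvd m)) hg
  · intro i j
    rw [hfib out, (tallyIf_output hcolk (fun x hx => (hlab x hx).trans_le (by omega)) hsl2 hFR hout i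
      j.2).1, hsl, tallyIf_slotLabel i (hdvd j)]
  · intro i _ j
    rw [hfib lab, ← tallyIf_slotLabel i (hdvd j), ← hsl,
      ← (tallyIf_output hcolk (fun x hx => (hlab x hx).trans_le (by omega)) hsl2 hFR hout i j.2).2]
    exact colorCount_filter hcol (fun x => lab x = i ∧ out x = i)
      (fun v => by rw [Finset.mem_inter, mem_fiber, mem_fiber]) j
  · exact fun i hi => tally_unitLabel_le_one hE.lt hi
  · intro i hi
    rw [hround, ← hE.tally_eq, tally_unitLabel (E := E) (c := c) (g := g) hi]
    omega
  · intro i hi i' hi' h h'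
    rw [hround, ← hE.tally_eq, tally_unitLabel (E := E) (c := c) (g := g) hi] at h
    -- A withdrawn unit sits among the first `c - g` entries and a surviving one later, so the
    -- sortedness of the list compares their clusters.
    obtain ⟨e, he, rfl⟩ := Nat.count_ne_iff_exists.1
      (show tally E (c - g) i ≠ 0 by omega)
    obtain ⟨u, hu, hu'⟩ := Nat.count_ne_iff_exists.1 h'
    rw [unitLabel] at hu'
    split_ifs at hu' with hlt
    · rw [hcard, hcard, ← hu']
      exact hE.sorted _ _ (by omega) hlt
    · omega
  · rcases le_total g c with h | h
    · right
      intro i hi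
      refine Nat.count_iff_forall_not.2 fun u hu hu' => ?_
      rw [unitLabel, if_pos (by omega)] at hu'
      have := hE.lt (u + (c - g)) (by omega)
      omega
    · left
      intro i hi
      rw [hround, ← hE.tally_eq, tally_unitLabel (E := E) (c := c) (g := g) hi, Nat.sub_eq_zero_of_le h, tally_zero,
        zero_add]

end Transfer

namespace Clustering

open Classical in
theorem exists_represents {V : Type*} [Fintype V] [DecidableEq V] (lab : V → ℕ) :
    ∃ C : Clustering V, C.Represents lab := by
  refine ⟨Finpartition.ofSetoid (Setoid.ker lab), fun u v => ?_⟩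
  rw [together_iff_mem_part, Finpartition.mem_part_ofSetoid_iff_rel]
  rfl

end Clustering

/-! ### The complete algorithm, its running time and the theorem. -/

namespace WordRAM

/-- The complete algorithm. -/
def fairProgram : Program :=
  .seq countProgram (.seq selectProgram (.seq emitProgram
    (.seq slotProgram (.seq freeProgram outputProgram))))

open Clustering

theorem total_fairProgram {n k w : ℕ} (color : Fin n → Fin k) (lab : Fin n → Fin n)
    (hw : 2 * (n + k + 1).size ≤ w) :
    Total w fairProgram (inputState color lab) (400 * ((n + 1) * (n.size + 1))) fun s =>
      0 < n → ∃ (g : ℕ) (p : Fin k → ℕ) (m : Fin k) (t' : ℕ → ℕ), IsRounding color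
        (fun v => (lab v : ℕ)) (outputLabels n s) n g p m t' := by
  obtain ⟨W, hW⟩ : ∃ W, 2 ^ w = W := ⟨_, rfl⟩
  have hWn : n * n + 2 * (n * k) + 4 * n + k + 4 ≤ W := by
    -- Twice the binary length of n + k + 1 makes the word size at least (n + k + 2)², enough for
    -- all indices.
    have h1 : (2 ^ (n + k + 1).size) ^ 2 ≤ W := by
      rw [← hW, ← pow_mul, mul_comm]
      exact Nat.pow_le_pow_right (by norm_num) hw
    have h2 : n + k + 2 ≤ 2 ^ (n + k + 1).size := Nat.lt_size_self (n + k + 1)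
    have h3 := Nat.pow_le_pow_left h2 2
    nlinarith
  set col' : ℕ → ℕ := (inputState color lab).arr 0 with hcol'
  set lab' : ℕ → ℕ := (inputState color lab).arr 1 with hlab'
  have hcol : ∀ v : Fin n, col' v = color v := fun v => by simp [hcol', inputState]
  have hlab : ∀ v : Fin n, lab' v = lab v := fun v => by simp [hlab', inputState]
  have hcolk : ∀ x < n, col' x < k := fun x hx => by
    rw [show col' x = color ⟨x, hx⟩ from hcol ⟨x, hx⟩]; exact (color _).2
  have hlabn : ∀ x < n, lab' x < n := fun x hx => by
    rw [show lab' x = lab ⟨x, hx⟩ from hlab ⟨x, hx⟩]; exact (lab _).2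
  have hblank : (inputState color lab).BlankFrom 3 := by
    intro b hb
    funext i
    simp only [inputState]
    split_ifs
    · omega
    · omega
    · rfl
    · rfl
  have h0 : (inputState color lab).HasInput n k col' lab' := ⟨rfl, rfl, rfl, rfl⟩
  have h1 := total_countProgram hW (by omega) h0 hblank
  refine (h1.seq (B' := (n * (n.size * 20 + 34) + 16) + ((n.size * (n * 48 + 16) + 14) +
    ((n * 80 + 6) + ((n * 80 + 6) + (n * 80 + 6))))) fun s hs => ?_).mono
    (by nlinarith [Nat.zero_le (n * n.size)]) fun _ h => h
  obtain ⟨h, h3, h4, hs⟩ := hs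
  refine (total_selectProgram hW (by omega) h h3 h4 hs).seq fun s hs => ?_
  obtain ⟨h, h4, hs, m, g, hsel, hm, hg, hp⟩ := hs
  refine (total_emitProgram hW (by nlinarith) h hlabn h4 hs hm hg hp).seq fun s hs => ?_
  obtain ⟨h, hs, hg, hd, hc, hE⟩ := hs
  have hgn : 0 < n → 0 < g ∧ g ≤ n := by
    intro hn
    have h5 : 0 < tally col' n (col' 0) := (Nat.zero_le _).trans_lt (tally_lt_of_lt hn)
    exact ⟨Nat.pos_of_dvd_of_pos (hsel.dvd 0 hn) h5,
      (Nat.le_of_dvd h5 (hsel.dvd 0 hn)).trans tally_le⟩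
  generalize hcc : s.reg 8 = c at *
  generalize hEE : s.arr 6 = E at *
  refine (total_slotProgram hW hWn h hlabn hcolk hs hg hgn hcc hc hd hEE hE.lt).seq
    fun s hs => ?_
  obtain ⟨h, hs, h8, h9, h10⟩ := hs
  refine (total_freeProgram hW hWn h hcolk (fun x hx => ?_) hs h8 h9 h10).seq fun s hs => ?_
  · exact slotLabel_lt hE.lt (hgn (by omega)).1 (hgn (by omega)).2
  obtain ⟨h, hs, h9, h13⟩ := hs
  refine (total_outputProgram hW hWn h hlabn hcolk hs h9 rfl).mono le_rfl fun s' h2 => ?_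
  intro hn
  obtain ⟨p, mc, t', hr⟩ := isRounding_of_emission hn hcol hlabn hsel hE h13 h2
  refine ⟨g, p, mc, t', ?_⟩
  rwa [show (fun v : Fin n => lab' v) = fun v => (lab v : ℕ) from funext hlab] at hr

end WordRAM

/-- The length minus one is at most the binary logarithm. For `n ≥ 2` the length is at most twice
that, and 2 / log 2 < 4. -/
theorem size_le_log_mul {n : ℕ} (hn : 2 ≤ n) : ((n.size : ℕ) : ℝ) ≤ 4 * Real.log n := by
  have h1 : 2 ^ (n.size - 1) ≤ n := Nat.lt_size.1 (by
    have := Nat.size_pos.2 (show 0 < n by omega)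
    omega)
  have h2 : 2 ≤ n.size := Nat.lt_size.2 (by omega)
  have h3 : ((n.size - 1 : ℕ) : ℝ) * Real.log 2 ≤ Real.log n := by
    rw [← Real.log_pow]
    exact Real.log_le_log (by positivity) (by exact_mod_cast h1)
  have h4 : ((n.size : ℕ) : ℝ) ≤ 2 * ((n.size - 1 : ℕ) : ℝ) := by
    exact_mod_cast (by omega : n.size ≤ 2 * (n.size - 1))
  have h5 := Real.log_two_gt_d9
  have h6 : (0 : ℝ) ≤ ((n.size - 1 : ℕ) : ℝ) := by positivity
  nlinarith

theorem mul_size_isBigO :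
    (fun n : ℕ => ((400 * ((n + 1) * (n.size + 1)) : ℕ) : ℝ)) =O[Filter.atTop]
      (fun n : ℕ => (n : ℝ) * Real.log (n : ℝ)) := by
  refine Asymptotics.IsBigO.of_bound (400 * (2 * 8)) ?_
  filter_upwards [Filter.eventually_ge_atTop 2] with n hn
  have h1 := size_le_log_mul hn
  have h2 : (1 : ℝ) ≤ n.size := by
    exact_mod_cast Nat.size_pos.2 (show 0 < n by omega)
  have h3 : (1 : ℝ) ≤ n := by exact_mod_cast (show 1 ≤ n by omega)
  rw [Real.norm_of_nonneg (by positivity), Real.norm_of_nonneg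
    (mul_nonneg (by positivity) (Real.log_nonneg h3))]
  push_cast
  have h4 : ((n : ℝ) + 1) * (n.size + 1) ≤ (2 * n) * (8 * Real.log n) :=
    mul_le_mul (by linarith) (by linarith) (by positivity) (by positivity)
  linarith

/-- There is an algorithm (one word RAM program) that, given a colored point set and a clustering
`D` of it, finds an `O(|χ| ^ 3.81)`-close fair clustering in time `O(|V| log |V|)`, on words of
any length `w` that is at least a constant times `log (|V| + |χ|)`. -/
theorem mainTheorem2 :
    ∃ (A : WordRAM.Program) (c : ℕ) (T : ℕ → ℕ) (K : ℝ),
      (fun n : ℕ => (T n : ℝ)) =O[Filter.atTop] (fun n : ℕ => (n : ℝ) * Real.log (n : ℝ)) ∧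
      ∀ (n k : ℕ) (color : Fin n → Fin k) (D : Clustering (Fin n)) (lab : Fin n → Fin n),
        D.Represents (fun v => (lab v : ℕ)) →
        ∀ w : ℕ, c * Nat.size (n + k + 1) ≤ w →
          ∃ (t : ℕ) (s : WordRAM.State),
            WordRAM.Runs w A (WordRAM.inputState color lab) t s ∧ t ≤ T n ∧
            ∃ F : Clustering (Fin n),
              F.Represents (WordRAM.outputLabels n s) ∧
              Clustering.IsCloseFair (K * (k : ℝ) ^ (3.81 : ℝ)) color D F := by
  refine ⟨WordRAM.fairProgram, 2, fun n => 400 * ((n + 1) * (n.size + 1)), 38, mul_size_isBigO, ?_⟩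
  intro n k color D lab hD w hw
  obtain ⟨t, s, hrun, ht, hs⟩ := WordRAM.total_fairProgram color lab hw
  obtain ⟨F, hF⟩ := Clustering.exists_represents (WordRAM.outputLabels n s)
  refine ⟨t, s, hrun, ht, F, hF, ?_⟩
  -- Without points there is no most frequent colour and hence no rounding, but all distances
  -- vanish.
  rcases Nat.eq_zero_or_pos n with rfl | hn
  · refine ⟨fun S hS => ?_, fun Fo _ => ?_⟩
    · obtain ⟨u, -⟩ := F.nonempty_of_mem_parts hS
      exact u.elim0
    · have h := Clustering.two_mul_pairDist D F
      rw [Finset.univ_eq_empty, Finset.sum_empty] at h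
      rw [show D.pairDist F = 0 by omega, Nat.cast_zero]
      positivity
  · obtain ⟨g, p, m, t', hr⟩ := hs hn
    refine ⟨hr.isFair hF, fun Fo hFo => ?_⟩
    have h1 := hr.pairDist_le hD hF hFo.1
    rw [Fintype.card_fin] at h1
    have h2 : (1 : ℝ) ≤ k := by exact_mod_cast Fin.pos m
    -- The analysis yields exponent 2; passing to 3.81 uses k ≥ 1, which holds as some colour
    -- occurs.
    have h3 : (k : ℝ) ^ (2 : ℕ) ≤ (k : ℝ) ^ (3.81 : ℝ) := by
      rw [← Real.rpow_natCast]
      exact Real.rpow_le_rpow_of_exponent_le h2 (by norm_num)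
    calc (D.pairDist F : ℝ) ≤ 38 * (k : ℝ) ^ (2 : ℕ) * D.pairDist Fo := by exact_mod_cast h1
      _ ≤ 38 * (k : ℝ) ^ (3.81 : ℝ) * D.pairDist Fo := by gcongr
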